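/- **Setting.** Fix $d$ and smooth radial functions $\chi,\rho:\mathbb R^d\to\mathbb R$ with $\operatorname{supp}\chi\subset\{|x|<\frac43\}$, $\operatorname{supp}\rho\subset\{\frac34<|x|<\frac83\}$ and $\chi(x)+\sum_{j\ge0}\rho(2^{-j}x)=1$ for all $x\in\mathbb R^d$. Put $\rho_{-1}=\chi$, $\rho_j=\rho(2^{-j}\cdot)$ for $j\ge0$, and for $f\in\mathcal S'(\mathbb R^d)$ let $\Delta_jf=\mathcal F^{-1}(\rho_j\mathcal Ff)$. For $\alpha\in\mathbb R$ let $\|f\|_\alpha=\sup_{j\ge-1}2^{j\alpha}\|\Delta_jf\|_{L^\infty}$ and $\mathcal C^\alpha=\{f\in\mathcal S'(\mathbb R^d):\|f\|_\alpha<\infty\}$. The paraproduct is $f\prec g=\sum_{j<k-1}\Delta_jf\,\Delta_kg$, i.e. the series over $k$ of $\big(\sum_{j<k-1}\Delta_jf\big)\Delta_kg$, converging in $\mathcal S'$. The iterated paraproducts are $(f_1)^\prec=f_1$ and $(f_1,\dots,f_n)^\prec=(f_1,\dots,f_{n-1})^\prec\prec f_n$. **Theorem.** Let $n\ge1$ and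 $\alpha_1,\dots,\alpha_n\in(0,1)$. (0) For all $f_i\in\mathcal C^{\alpha_i}$, $i=1,\dots,n$, and every nonempty word $(i_1\dots i_k)$ in the letters $1,\dots,n$, the iterated paraproduct $(f_{i_1},\dots,f_{i_k})^\prec$ is well defined (all the series converge) and is a bounded continuous function. (1) Define inductively, for $x,y\in\mathbb R^d$, $$\omega^\prec_{yx}(f_1,\dots,f_n)=(f_1,\dots,f_n)^\prec(y)-(f_1,\dots,f_n)^\prec(x)-\sum_{\ell=1}^{n-1}(f_1,\dots,f_\ell)^\prec(x)\,\omega^\prec_{yx}(f_{\ell+1},\dots,f_n).$$ If $\alpha_1+\dots+\alpha_n<1$, then there is a constant $C$, depending only on $d,\chi,\rho,n,\alpha_1,\dots,\alpha_n$, such that for all $f_i\in\mathcal C^{\alpha_i}$ and all $x,y\in\mathbb R^d$ $$|\omega^\prec_{yx}(f_1,\dots,f_n)|\le C\,\|f_1\|_{\alpha_1}\cdots\|f_n\|_{\alpha_n}\,|y-x|^{\alpha_1+\dots+\alpha_n}.$$ (2) Without assuming $\alpha_1+\dots+\alpha_n<1$, let $W^{<1}$ be the set of nonempty words $(i_1\dots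 i_k)$ in the letters $1,\dots,n$ with $\alpha_{i_1}+\dots+\alpha_{i_k}<1$. For a family $F=\{f^{w}\}_{w\in W^{<1}}$ of functions on $\mathbb R^d$ put $$\omega_{yx}^{i_1\dots i_k}(F)=f^{i_1\dots i_k}(y)-f^{i_1\dots i_k}(x)-\sum_{\ell=1}^{k-1}f^{i_1\dots i_\ell}(x)\,\omega_{yx}^{i_{\ell+1}\dots i_k}(F),$$ and call $F$ a *seed of model* if $$\sup_{w\in W^{<1}}\sup_{x}|f^{w}(x)|+\sup_{(i_1\dots i_k)\in W^{<1}}\sup_{x, y}\frac{|\omega^{i_1\dots i_k}_{yx}(F)|}{|y-x|^{\alpha_{i_1}+\dots+\alpha_{i_k}}}<\infty$$ (with $0/0=0$ on the diagonal). Then for all $f_i\in\mathcal C^{\alpha_i}$ the family $F^\prec=\{(f_{i_1},\dots,f_{i_k})^\prec\}_{(i_1\dots i_k)\in W^{<1}}$ is a seed of model. Moreover, with a constant $C$ depending only on $d,\chi,\rho,n,\alpha_1,\dots,\alpha_n$, for all $f_i\in\mathcal C^{\alpha_i}$, all $(i_1\dots i_k)\in W^{<1}$ and all $x,y\in\mathbb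 R^d$, $$|\omega_{yx}^{i_1\dots i_k}(F^\prec)|\le C\,\|f_{i_1}\|_{\alpha_{i_1}}\cdots\|f_{i_k}\|_{\alpha_{i_k}}\,|y-x|^{\alpha_{i_1}+\dots+\alpha_{i_k}}.$$ -/

import Mathlib

open scoped SchwartzMap ENNReal ContDiff
open MeasureTheory

noncomputable section

namespace IterPara

/-- The Euclidean space `ℝᵈ`. -/
abbrev E (d : ℕ) : Type := EuclideanSpace ℝ (Fin d)

/-- Tempered distributions on `ℝᵈ` (complex valued; real ones are a special case). -/
abbrev Distr (d : ℕ) : Type := 𝓢'(E d, ℂ)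

/-! ### Distributions and functions -/

/-- The distribution `u` is the function `a`, i.e. `⟨u, φ⟩ = ∫ φ a` for all Schwartz `φ`. -/
def Represents {d : ℕ} (a : E d → ℂ) (u : Distr d) : Prop :=
  ∀ φ : 𝓢(E d, ℂ), Integrable (fun x => φ x * a x) volume ∧ u φ = ∫ x, φ x * a x

/-- The distribution `u` is a continuous function. -/
def IsContFun {d : ℕ} (u : Distr d) : Prop :=
  ∃ a : E d → ℂ, Continuous a ∧ Represents a u

open Classical in
/-- The continuous function that the distribution `u` is (it is unique, see
`toFun_eq_of_represents`); `toFun u x` is the value `u(x)`.  Junk value `0` if `u` is not a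
continuous function. -/
def toFun {d : ℕ} (u : Distr d) : E d → ℂ :=
  if h : IsContFun u then h.choose else 0

open Classical in
/-- The tempered distribution given by the function `a`.  Junk value `0` if `a` does not define a
tempered distribution. -/
def ofFun {d : ℕ} (a : E d → ℂ) : Distr d :=
  if h : ∃ u, Represents a u then h.choose else 0

theorem ofFun_eq_of_represents {d : ℕ} {a : E d → ℂ} {u : Distr d} (h : Represents a u) :
    ofFun a = u := by
  have hex : ∃ u, Represents a u := ⟨u, h⟩
  rw [ofFun, dif_pos hex]
  ext φ
  rw [(hex.choose_spec φ).2, (h φ).2]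

theorem toFun_eq_of_represents {d : ℕ} {a : E d → ℂ} {u : Distr d} (hc : Continuous a)
    (h : Represents a u) : toFun u = a := by
  have hex : IsContFun u := ⟨a, hc, h⟩
  rw [toFun, dif_pos hex]
  obtain ⟨hbc, hb⟩ := hex.choose_spec
  set b := hex.choose
  have key : ∀ᵐ x ∂(volume : Measure (E d)), (b - a) x = 0 := by
    apply ae_eq_zero_of_integral_contDiff_smul_eq_zero
    · exact (hbc.sub hc).locallyIntegrable
    · intro g g_smooth g_cpt
      have hg₁ : HasCompactSupport (Complex.ofRealCLM ∘ g) := g_cpt.comp_left rfl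
      have hg₂ : ContDiff ℝ ∞ (Complex.ofRealCLM ∘ g) := by fun_prop
      have h1 := hb (hg₁.toSchwartzMap hg₂)
      have h2 := h (hg₁.toSchwartzMap hg₂)
      have h3 := integral_sub h1.1 h2.1
      rw [← h1.2, ← h2.2, sub_self] at h3
      rw [← h3]
      congr 1
      ext x
      simp [mul_sub]
  have h0 : (b - a) = 0 :=
    Continuous.ae_eq_iff_eq volume (hbc.sub hc) continuous_zero |>.1 key
  exact sub_eq_zero.1 h0

/-- The `L^∞` norm of a distribution (`⊤` if the distribution is not an `L^∞` function). -/
def linftyNorm {d : ℕ} (u : Distr d) : ℝ≥0∞ :=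
  ⨅ (g : Lp ℂ ∞ (volume : Measure (E d))) (_ : Lp.toTemperedDistribution g = u), ‖g‖ₑ

/-! ### Littlewood–Paley blocks, Besov spaces, paraproducts -/

/-- A pair of smooth radial functions generating a dyadic partition of unity. -/
structure IsDyadicPartition {d : ℕ} (χ ρ : E d → ℝ) : Prop where
  smooth_χ : ContDiff ℝ ∞ χ
  smooth_ρ : ContDiff ℝ ∞ ρ
  radial_χ : ∀ x y, ‖x‖ = ‖y‖ → χ x = χ y
  radial_ρ : ∀ x y, ‖x‖ = ‖y‖ → ρ x = ρ y
  supp_χ : tsupport χ ⊆ {x | ‖x‖ < 4 / 3}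
  supp_ρ : tsupport ρ ⊆ {x | 3 / 4 < ‖x‖ ∧ ‖x‖ < 8 / 3}
  sum_eq_one : ∀ x, χ x + ∑' j : ℕ, ρ (((2 : ℝ) ^ j)⁻¹ • x) = 1

/-- The symbols `ρ_{-1} = χ` and `ρ_j = ρ(2^{-j} ·)`, `j ≥ 0`, with the index shifted by one:
`symbol χ ρ m = ρ_{m-1}`. -/
def symbol {d : ℕ} (χ ρ : E d → ℝ) : ℕ → E d → ℝ
  | 0 => χ
  | j + 1 => fun ξ => ρ (((2 : ℝ) ^ j)⁻¹ • ξ)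

/-- The Littlewood–Paley block `f ↦ 𝓕⁻¹ (ρ_{m-1} 𝓕 f)` on tempered distributions, i.e.
`block χ ρ m f = Δ_{m-1} f`. -/
def block {d : ℕ} (χ ρ : E d → ℝ) (m : ℕ) (f : Distr d) : Distr d :=
  TemperedDistribution.fourierMultiplierCLM ℂ (fun ξ => (symbol χ ρ m ξ : ℂ)) f

/-- The Besov norm `‖f‖_α = sup_{j ≥ -1} 2^{jα} ‖Δ_j f‖_{L^∞}`, with `j = m - 1`. -/
def besovNorm {d : ℕ} (χ ρ : E d → ℝ) (α : ℝ) (f : Distr d) : ℝ≥0∞ :=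
  ⨆ m : ℕ, ENNReal.ofReal ((2 : ℝ) ^ (((m : ℝ) - 1) * α)) * linftyNorm (block χ ρ m f)

/-- `f` belongs to the Besov space `𝒞^α`. -/
def MemBesov {d : ℕ} (χ ρ : E d → ℝ) (α : ℝ) (f : Distr d) : Prop :=
  besovNorm χ ρ α f < ⊤

/-- The function `x ↦ ∑_{j < k - 1} Δ_j f(x) Δ_k g(x)` (all indices shifted by one, which does not
change the condition `j < k - 1`, that is `j + 1 < k`). -/
def paraTerm {d : ℕ} (χ ρ : E d → ℝ) (f g : Distr d) (k : ℕ) : E d → ℂ :=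
  fun x => ∑ j ∈ Finset.range (k - 1), toFun (block χ ρ j f) x * toFun (block χ ρ k g) x

/-- The paraproduct `f ≺ g = ∑_{j < k - 1} Δ_j f Δ_k g`, the series converging in `𝓢'`. -/
def paraproduct {d : ℕ} (χ ρ : E d → ℝ) (f g : Distr d) : Distr d :=
  ∑' k : ℕ, ofFun (paraTerm χ ρ f g k)

/-- No junk value occurs in `paraproduct χ ρ f g`: the blocks are continuous functions, their
products define tempered distributions, and the series converges in `𝓢'`. -/
structure ParaproductDefined {d : ℕ} (χ ρ : E d → ℝ) (f g : Distr d) : Prop where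
  left : ∀ m, IsContFun (block χ ρ m f)
  right : ∀ m, IsContFun (block χ ρ m g)
  term : ∀ k, ∃ u, Represents (paraTerm χ ρ f g k) u
  summable : Summable fun k => ofFun (paraTerm χ ρ f g k)

/-- The iterated paraproduct `(f₁, …, fₙ)^≺ = (⋯((f₁ ≺ f₂) ≺ f₃) ⋯) ≺ fₙ` of a nonempty list
(the value `0` at the empty list plays no role). -/
def iterPara {d : ℕ} (χ ρ : E d → ℝ) : List (Distr d) → Distr d
  | [] => 0
  | f :: fs => fs.foldl (paraproduct χ ρ) f

/-! ### Increments and seeds -/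

/-- For functions `F w` on `X` indexed by words `w` in an alphabet `ι`, the increment
`ω_{yx}^{i₁…i_k} = F^{i₁…i_k}(y) - F^{i₁…i_k}(x) - ∑_{ℓ=1}^{k-1} F^{i₁…i_ℓ}(x) ω_{yx}^{i_{ℓ+1}…i_k}`
(below `ℓ = i + 1`). -/
def increment {ι X : Type*} (F : List ι → X → ℂ) (y x : X) (w : List ι) : ℂ :=
  F w y - F w x -
    ∑ i : Fin (w.length - 1),
      F (w.take (i + 1)) x * increment F y x (w.drop (i + 1))
termination_by w.length
decreasing_by
  have := i.isLt
  simp only [List.length_drop]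
  omega

/-- The increment `ω^≺_{yx}(f₁, …, fₙ)` of iterated paraproducts. -/
def omegaPara {d : ℕ} (χ ρ : E d → ℝ) (y x : E d) (fs : List (Distr d)) : ℂ :=
  increment (fun gs : List (Distr d) => toFun (iterPara χ ρ gs)) y x fs

/-- The homogeneity `|i₁…i_k| = α_{i₁} + ⋯ + α_{i_k}` of a word. -/
def homogeneity {n : ℕ} (α : Fin n → ℝ) (w : List (Fin n)) : ℝ := (w.map α).sum

/-- The nonempty words of homogeneity `< 1` in the alphabet `{1, …, n}`. -/
def words {n : ℕ} (α : Fin n → ℝ) : Set (List (Fin n)) :=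
  {w | w ≠ [] ∧ homogeneity α w < 1}

/-- The quantity `‖F‖` of a family of functions indexed by the words of homogeneity `< 1`
(only those `F w` with `w ∈ words α` enter; on the diagonal the quotient is `0 / 0 = 0`). -/
def seedNorm {d n : ℕ} (α : Fin n → ℝ) (F : List (Fin n) → E d → ℂ) : ℝ≥0∞ :=
  (⨆ w ∈ words α, ⨆ x, ‖F w x‖ₑ) +
    ⨆ w ∈ words α, ⨆ x, ⨆ y,
      ‖increment F y x w‖ₑ / ENNReal.ofReal (‖y - x‖ ^ homogeneity α w)

/-- The family `F` is a seed of model. -/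
def IsSeed {d n : ℕ} (α : Fin n → ℝ) (F : List (Fin n) → E d → ℂ) : Prop :=
  seedNorm α F < ⊤

/-- The family `F^≺` of functions `(f_{i₁}, …, f_{i_k})^≺`, indexed by words. -/
def paraFamily {d n : ℕ} (χ ρ : E d → ℝ) (f : Fin n → Distr d) (w : List (Fin n)) : E d → ℂ :=
  toFun (iterPara χ ρ (w.map f))

end IterPara

end

/-!
Increments of iterated paraproducts satisfy the same recursion as iterated paraproducts. Fix `x`.
As functions of `y`, the increments `ω_{yx}` of the word `w i` and of the word `w` are related by

  `ω_{yx}(w i) = (ω_{·x}(w) ≺ f_i)(y) + c(x) (Δ_{-1} f_i + Δ_0 f_i)(y) + c'(x)`,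

with `c(x)` bounded (`exists_extIncrement_concat`): subtracting the lower order terms in the
definition of `ω` commutes with `· ≺ f_i` because their coefficients do not depend on `y`, and the
last term of the sum, which is a multiple of `f_i` itself, is `1 ≺ f_i` up to two low frequency
blocks. Since `ω_{xx} = 0`, it suffices to bound the increments of the right-hand side between `x`
and `y`. Assume by induction that `|ω_{zx}(w)| ≤ A |z - x|^β`. The low frequency part of `ω_{·x}(w)`
at frequency `2^k` is an average at scale `2^{-k}` with a Schwartz kernel, so that its size at
distance `r ≥ 2^{-k}` from `x` is `A r^β`, and at distance at most `2^{-k}` from `x` it is Lipschitz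
with constant `2^k A 2^{-kβ}` (`exists_scaledConv_bound`). Multiplying by `Δ_k f_i`, which is of
size `2^{-kα}` and Lipschitz with constant `2^k 2^{-kα}`, and summing over `k` gives an increment of
size `|y - x|^{α + β}`: frequencies above `1 / |y - x|` are summed thanks to `α > 0`, the other ones
thanks to `α + β < 1` (`exists_paraSum_sub_bound`). No Fourier localization of products is needed.

The rest identifies the distributions in the statement with these functions. A Fourier multiplier
with test function symbol acts on bounded functions by averaging against a Schwartz kernel
(`represents_fourierMultiplierCLM`), whence Bernstein's inequality for the blocks of `f ∈ 𝒞^α`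
(`exists_isBlockSeq`). The blocks of `f` sum up to `f` as `χ(2^{-N} ·) ψ → ψ` in the Schwartz space
(`tendsto_smulLeftCLM_dilate`), and for `α > 0` the series `g ≺ f` with `g` bounded and continuous
converges uniformly (`IsDyadicPartition.paraproduct_represents`).
-/

noncomputable section

namespace IterPara

open FourierTransform TemperedDistribution

variable {d : ℕ}

/-! ### Fourier multipliers acting on bounded functions -/

/-- The average `x ↦ ∫ κ(v) g(x + t v) dv` of `g` at scale `t` with respect to the kernel `κ`.
With `κ = 𝓕 a` this is the action of the Fourier multiplier with symbol `a(t ·)` on `g`, see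
`represents_fourierMultiplierCLM`; the Fourier transform (rather than its inverse) appears since
`v` is the opposite of the usual convolution variable. -/
def scaledConv (κ : 𝓢(E d, ℂ)) (t : ℝ) (g : E d → ℂ) (x : E d) : ℂ :=
  ∫ v, κ v * g (x + t • v)

theorem fourier_comp_smul (a : E d → ℂ) {t : ℝ} (ht : 0 < t) (w : E d) :
    𝓕 (fun ξ => a (t • ξ)) w = ((t ^ d)⁻¹ : ℝ) • 𝓕 a (t⁻¹ • w) := by
  have h := Measure.integral_comp_smul_of_nonneg (μ := volume)
    (fun ξ : E d => Real.fourierChar (-(inner ℝ ξ (t⁻¹ • w))) • a ξ) t (hR := ht.le)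
  rw [Real.fourier_eq, Real.fourier_eq]
  simp only [finrank_euclideanSpace, Fintype.card_fin] at h
  rw [← h]
  congr 1
  ext ξ
  rw [inner_smul_left, inner_smul_right]
  simp [ht.ne']

/-- On the Schwartz side, a Fourier multiplier is the convolution with the transformed symbol. -/
theorem fourier_smulLeftCLM_fourierInv_apply (b φ : 𝓢(E d, ℂ)) (z : E d) :
    𝓕 (SchwartzMap.smulLeftCLM ℂ b (𝓕⁻ φ)) z = ∫ x, 𝓕 b (z - x) * φ x := by
  let neg := SchwartzMap.compCLMOfContinuousLinearEquiv ℂ (D := E d) (F := ℂ)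
    (LinearIsometryEquiv.neg ℝ (E := E d)).toContinuousLinearEquiv
  have hneg : ∀ f : 𝓢(E d, ℂ), 𝓕 (neg f) = 𝓕⁻ f := by
    intro f
    ext x
    rw [SchwartzMap.fourierInv_coe, SchwartzMap.fourier_coe, Real.fourierInv_eq_fourier_comp_neg]
    rfl
  have h := SchwartzMap.fourier_convolution (ContinuousLinearMap.mul ℂ ℂ) (neg (𝓕 b)) (neg φ)
  have h2 : SchwartzMap.smulLeftCLM ℂ b (𝓕⁻ φ) =
      𝓕 (SchwartzMap.convolution (ContinuousLinearMap.mul ℂ ℂ) (neg (𝓕 b)) (neg φ)) := by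
    rw [h, hneg, hneg]
    ext x
    simp [SchwartzMap.smulLeftCLM_apply_apply b.hasTemperateGrowth]
  have h3 : ∀ f : 𝓢(E d, ℂ), 𝓕 f z = 𝓕⁻ f (-z) := by
    intro f
    rw [SchwartzMap.fourierInv_coe, SchwartzMap.fourier_coe, Real.fourierInv_eq_fourier_neg,
      neg_neg]
  rw [h3, h2, fourierInv_fourier_eq, SchwartzMap.convolution_apply]
  rw [convolution]
  rw [← integral_sub_right_eq_self _ z]
  congr 1
  ext w
  simp [neg]

/-- The dilation `x ↦ a(t x)` of a Schwartz function, `t > 0`. -/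
def dilate (a : 𝓢(E d, ℂ)) (t : ℝ) (ht : 0 < t) : 𝓢(E d, ℂ) :=
  SchwartzMap.compCLMOfContinuousLinearEquiv ℂ
    (ContinuousLinearEquiv.smulLeft (Units.mk0 t ht.ne')) a

theorem dilate_apply (a : 𝓢(E d, ℂ)) (t : ℝ) (ht : 0 < t) (x : E d) :
    dilate a t ht x = a (t • x) := rfl

/-- A Fourier multiplier with Schwartz symbol maps a bounded function to its average against the
rescaled kernel. By duality the multiplier falls on the test function, and Fubini moves the
resulting convolution back to `g`. -/
theorem represents_fourierMultiplierCLM (a : 𝓢(E d, ℂ)) {t : ℝ} (ht : 0 < t) {g : E d → ℂ}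
    (hg : Measurable g) {A : ℝ} (hA : ∀ x, ‖g x‖ ≤ A) {u : Distr d} (hu : Represents g u) :
    Represents (scaledConv (𝓕 a) t g) (fourierMultiplierCLM ℂ (fun ξ => a (t • ξ)) u) := by
  have hconv : ∀ x, scaledConv (𝓕 a) t g x =
      ∫ z, 𝓕 (dilate a t ht) (z - x) * g z := by
    intro x
    rw [← integral_add_left_eq_self _ x]
    have h1 : ∀ v, 𝓕 (dilate a t ht) v = ((t ^ d)⁻¹ : ℝ) • 𝓕 a (t⁻¹ • v) := by
      intro v
      exact fourier_comp_smul a ht v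
    have h2 := Measure.integral_comp_smul_of_nonneg (μ := volume)
      (fun v => 𝓕 (dilate a t ht) v * g (x + v)) t (hR := ht.le)
    simp only [finrank_euclideanSpace, Fintype.card_fin] at h2
    simp only [add_sub_cancel_left]
    have h3 : ∫ v, 𝓕 (dilate a t ht) v * g (x + v) =
        (t ^ d : ℝ) • ∫ v, 𝓕 (dilate a t ht) (t • v) * g (x + t • v) := by
      rw [h2, smul_smul, mul_inv_cancel₀ (by positivity), one_smul]
    rw [h3, scaledConv, ← integral_smul]
    congr 1
    ext v
    rw [h1, smul_smul, inv_mul_cancel₀ ht.ne', one_smul, smul_mul_assoc, smul_smul,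
      mul_inv_cancel₀ (by positivity), one_smul]
  intro φ
  set κ := 𝓕 (dilate a t ht) with hκ
  have hint : Integrable (fun p : E d × E d => κ (p.1 - p.2) * φ p.2 * g p.1)
      ((volume : Measure (E d)).prod volume) := by
    have h1 := (φ.integrable (μ := volume)).convolution_integrand (ContinuousLinearMap.mul ℂ ℂ).flip
      (κ.integrable (μ := volume))
    refine Integrable.mul_bdd (c := A) ?_ ?_ ?_
    · exact h1
    · exact (hg.comp measurable_fst).aestronglyMeasurable
    · exact Filter.Eventually.of_forall fun p => hA _
  have heq : ∀ x, φ x * scaledConv (𝓕 a) t g x = ∫ z, κ (z - x) * φ x * g z := by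
    intro x
    rw [hconv, ← integral_const_mul]
    congr 1
    ext z
    ring
  simp_rw [heq]
  refine ⟨hint.integral_prod_right, ?_⟩
  rw [fourierMultiplierCLM_apply_apply, (hu _).2, ← integral_integral_swap hint]
  congr 1
  ext z
  rw [integral_mul_const, ← fourier_smulLeftCLM_fourierInv_apply]
  rfl

/-! ### Tempered distributions given by functions -/

theorem exists_represents {g : E d → ℂ}
    (hg : Measurable g) {A : ℝ} (hA : ∀ x, ‖g x‖ ≤ A) : ∃ u, Represents g u := by
  have hm : MemLp g ∞ (volume : Measure (E d)) :=
    memLp_top_of_bound hg.aestronglyMeasurable A (Filter.Eventually.of_forall hA)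
  refine ⟨Lp.toTemperedDistribution hm.toLp, fun φ => ⟨?_, ?_⟩⟩
  · exact (φ.integrable).mul_bdd (c := A) hg.aestronglyMeasurable (Filter.Eventually.of_forall hA)
  · rw [Lp.toTemperedDistribution_apply]
    refine integral_congr_ae ?_
    filter_upwards [hm.coeFn_toLp] with x hx
    rw [hx, smul_eq_mul]

/-- The class `g ∈ L^∞` has a measurable representative bounded by `‖g‖` everywhere. -/
theorem exists_represents_toTemperedDistribution (g : Lp ℂ ∞ (volume : Measure (E d))) :
    ∃ g' : E d → ℂ, Measurable g' ∧ (∀ x, ‖g' x‖ ≤ ‖g‖) ∧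
      Represents g' (Lp.toTemperedDistribution g) := by
  have hgm : Measurable g := (Lp.stronglyMeasurable g).measurable
  have hb : ∀ᵐ x ∂(volume : Measure (E d)), ‖g x‖ ≤ ‖g‖ := by
    filter_upwards [ae_le_eLpNormEssSup (f := g) (μ := (volume : Measure (E d)))] with x hx
    rw [← eLpNorm_exponent_top] at hx
    rw [Lp.norm_def, ← toReal_enorm]
    exact ENNReal.toReal_mono (Lp.eLpNorm_ne_top g) hx
  let s : Set (E d) := {x | ‖g x‖ ≤ ‖g‖}
  have hs : MeasurableSet s := measurableSet_le hgm.norm measurable_const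
  have hbd : ∀ x, ‖s.indicator g x‖ ≤ ‖g‖ := by
    intro x
    by_cases hx : x ∈ s
    · rw [Set.indicator_of_mem hx]; exact hx
    · rw [Set.indicator_of_notMem hx]; simp
  refine ⟨s.indicator g, hgm.indicator hs, hbd, fun φ => ⟨?_, ?_⟩⟩
  · exact (φ.integrable).mul_bdd (c := ‖g‖) (hgm.indicator hs).aestronglyMeasurable
      (Filter.Eventually.of_forall hbd)
  · rw [Lp.toTemperedDistribution_apply]
    refine integral_congr_ae ?_
    filter_upwards [hb] with x hx
    rw [Set.indicator_of_mem (show x ∈ s from hx), smul_eq_mul]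

theorem represents_ofFun {a : E d → ℂ} (h : ∃ u, Represents a u) : Represents a (ofFun a) := by
  obtain ⟨u, hu⟩ := h
  rwa [ofFun_eq_of_represents hu]

/-- A normally convergent series of functions converges in `𝓢'` to its sum. -/
theorem hasSum_of_represents {a : ℕ → E d → ℂ} {u : ℕ → Distr d} (hu : ∀ k, Represents (a k) (u k))
    {c : ℕ → ℝ} (hc : Summable c) (hac : ∀ k x, ‖a k x‖ ≤ c k)
    {v : Distr d} (hv : Represents (fun x => ∑' k, a k x) v) : HasSum u v := by
  rw [HasSum, PointwiseConvergenceCLM.tendsto_iff_forall_tendsto]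
  intro φ
  have : HasSum (fun k => u k φ) (v φ) := by
    rw [(hv φ).2]
    simp_rw [fun k => (hu k φ).2, ← tsum_mul_left]
    refine hasSum_integral_of_summable_integral_norm (fun k => (hu k φ).1) ?_
    refine Summable.of_nonneg_of_le (fun k => by positivity) (fun k => ?_)
      (hc.mul_left (∫ x, ‖φ x‖))
    rw [← integral_mul_const]
    refine integral_mono (hu k φ).1.norm (φ.integrable.norm.mul_const _) fun x => ?_
    simp only [norm_mul]
    gcongr
    exact hac k x
  simpa [HasSum] using this

theorem exists_represents_of_linftyNorm_lt {u : Distr d} (hu : linftyNorm u ≠ ⊤) {r : ℝ}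
    (hr : (linftyNorm u).toReal < r) :
    ∃ g : E d → ℂ, Measurable g ∧ (∀ x, ‖g x‖ ≤ r) ∧ Represents g u := by
  have h1 : linftyNorm u < ENNReal.ofReal r := (ENNReal.lt_ofReal_iff_toReal_lt hu).2 hr
  obtain ⟨g, hg⟩ := iInf_lt_iff.1 h1
  obtain ⟨hgu, hgr⟩ := iInf_lt_iff.1 hg
  obtain ⟨g', hm, hb, hrep⟩ := exists_represents_toTemperedDistribution g
  refine ⟨g', hm, fun x => (hb x).trans ?_, hgu ▸ hrep⟩
  rw [← toReal_enorm]
  exact ((ENNReal.lt_ofReal_iff_toReal_lt (by simp)).1 hgr).le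

theorem Represents.sum {ι : Type*} {s : Finset ι} {a : ι → E d → ℂ} {u : ι → Distr d}
    (h : ∀ i ∈ s, Represents (a i) (u i)) :
    Represents (fun x => ∑ i ∈ s, a i x) (∑ i ∈ s, u i) := by
  intro φ
  simp_rw [Finset.mul_sum]
  refine ⟨integrable_finsetSum s fun i hi => (h i hi φ).1, ?_⟩
  rw [integral_finsetSum s fun i hi => (h i hi φ).1, sum_apply]
  exact Finset.sum_congr rfl fun i hi => (h i hi φ).2

theorem represents_tsum {a : ℕ → E d → ℂ} {u : ℕ → Distr d} (hu : ∀ k, Represents (a k) (u k))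
    (ha : ∀ k, Continuous (a k)) {c : ℕ → ℝ} (hc : Summable c) (hac : ∀ k x, ‖a k x‖ ≤ c k) :
    ∃ v, HasSum u v ∧ Represents (fun x => ∑' k, a k x) v := by
  obtain ⟨v, hv⟩ := exists_represents (g := fun x => ∑' k, a k x)
    (continuous_tsum ha hc hac).measurable
    (fun x => tsum_of_norm_bounded hc.hasSum fun k => hac k x)
  exact ⟨v, hasSum_of_represents hu hc hac hv, hv⟩

/-! ### Averages against rescaled Schwartz kernels -/

theorem integrable_inv_one_add_norm_pow :
    Integrable (fun v : E d => ((1 + ‖v‖) ^ (d + 1))⁻¹) := by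
  have h := integrable_one_add_norm (E := E d) (μ := volume) (r := (d + 1 : ℕ)) (by simp)
  refine h.congr (Filter.Eventually.of_forall fun v => ?_)
  simp only
  rw [Real.rpow_neg (by positivity), Real.rpow_natCast]

/-- Decay of a Schwartz function and of its increments, in the form needed to integrate them
against a function of at most linear growth. -/
theorem exists_kernel_decay (κ : 𝓢(E d, ℂ)) : ∃ B : ℝ, 0 ≤ B ∧
    (∀ v, (1 + ‖v‖) * ‖κ v‖ ≤ B * ((1 + ‖v‖) ^ (d + 1))⁻¹) ∧
    ∀ v w, ‖w‖ ≤ 1 → (1 + ‖v‖) * ‖κ (v - w) - κ v‖ ≤ B * ‖w‖ * ((1 + ‖v‖) ^ (d + 1))⁻¹ := by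
  let S := ((2 : ℝ) ^ (d + 2)) * ((Finset.Iic (d + 2, 1)).sup
    fun m => SchwartzMap.seminorm ℝ m.1 m.2) κ
  have hS0 : 0 ≤ S := by positivity
  have h0 : ∀ v, (1 + ‖v‖) ^ (d + 2) * ‖κ v‖ ≤ S := fun v => by
    simpa using SchwartzMap.one_add_le_sup_seminorm_apply (𝕜 := ℝ) (m := (d + 2, 1)) (n := 0)
      le_rfl (by simp) κ v
  have h1 : ∀ v, (1 + ‖v‖) ^ (d + 2) * ‖fderiv ℝ κ v‖ ≤ S := fun v => by
    simpa using SchwartzMap.one_add_le_sup_seminorm_apply (𝕜 := ℝ) (m := (d + 2, 1)) (n := 1)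
      le_rfl le_rfl κ v
  have hle : S ≤ 2 ^ (d + 2) * S := le_mul_of_one_le_left hS0 (one_le_pow₀ (by norm_num))
  refine ⟨2 ^ (d + 2) * S, by positivity, fun v => ?_, fun v w hw => ?_⟩
  · rw [← div_eq_mul_inv, le_div_iff₀ (by positivity)]
    refine le_trans (le_of_eq ?_) ((h0 v).trans hle)
    ring
  · rw [← div_eq_mul_inv, le_div_iff₀ (by positivity)]
    -- the weights `1 + ‖u‖` are comparable on the ball of radius `1` about `v`
    have hb : ∀ u ∈ Metric.closedBall v 1,
        ‖fderiv ℝ κ u‖ ≤ 2 ^ (d + 2) * S / (1 + ‖v‖) ^ (d + 2) := by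
      intro u hu
      rw [le_div_iff₀ (by positivity)]
      have hvu : 1 + ‖v‖ ≤ 2 * (1 + ‖u‖) := by
        have h2 : ‖v‖ ≤ ‖u‖ + ‖v - u‖ := norm_le_norm_add_norm_sub' v u
        have h3 : ‖v - u‖ ≤ 1 := by rw [← dist_eq_norm, dist_comm]; exact hu
        linarith [norm_nonneg u]
      calc ‖fderiv ℝ κ u‖ * (1 + ‖v‖) ^ (d + 2)
          ≤ ‖fderiv ℝ κ u‖ * (2 * (1 + ‖u‖)) ^ (d + 2) := by gcongr
        _ = 2 ^ (d + 2) * ((1 + ‖u‖) ^ (d + 2) * ‖fderiv ℝ κ u‖) := by rw [mul_pow]; ring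
        _ ≤ 2 ^ (d + 2) * S := by gcongr; exact h1 u
    have h2 := (convex_closedBall v 1).norm_image_sub_le_of_norm_fderiv_le
      (fun u _ => κ.differentiableAt) hb (Metric.mem_closedBall_self zero_le_one)
      (show v - w ∈ Metric.closedBall v 1 by simpa [dist_eq_norm] using hw)
    rw [div_mul_eq_mul_div, le_div_iff₀ (by positivity)] at h2
    refine le_trans (le_of_eq ?_) (h2.trans (le_of_eq ?_))
    · ring
    · simp

/-- If `g` vanishes at order `β ≤ 1` at the point `x`, then its average at scale `t` has size
`r ^ β` at distance `r ≥ t` from `x`, and its increment from `x` to a point `y` at distance at most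
`t` has size `(‖y - x‖ / t) t ^ β`. For `β = 0` the hypothesis says that `g` is bounded. -/
theorem exists_scaledConv_bound (κ : 𝓢(E d, ℂ)) : ∃ M : ℝ, 0 ≤ M ∧
    ∀ (t A β : ℝ) (g : E d → ℂ) (x : E d), 0 < t → 0 ≤ A → 0 ≤ β → β ≤ 1 → Measurable g →
      (∀ z, ‖g z‖ ≤ A * ‖z - x‖ ^ β) →
      (∀ y r, ‖y - x‖ ≤ r → t ≤ r → ‖scaledConv κ t g y‖ ≤ M * A * r ^ β) ∧
      (∀ y, ‖y - x‖ ≤ t →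
        ‖scaledConv κ t g y - scaledConv κ t g x‖ ≤ M * A * (‖y - x‖ / t * t ^ β)) := by
  obtain ⟨B, hB, h0, h1⟩ := exists_kernel_decay κ
  set Φ : E d → ℝ := fun v => ((1 + ‖v‖) ^ (d + 1))⁻¹ with hΦ
  have hΦi : Integrable Φ := integrable_inv_one_add_norm_pow
  refine ⟨B * ∫ v, Φ v, mul_nonneg hB (integral_nonneg fun v => by positivity), ?_⟩
  intro t A β g x ht hA hβ hβ1 hg hgx
  have growth : ∀ y r, ‖y - x‖ ≤ r → t ≤ r → ∀ v,
      ‖g (y + t • v)‖ ≤ A * r ^ β * (1 + ‖v‖) := by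
    intro y r hy hr v
    have hr0 : 0 < r := ht.trans_le hr
    refine (hgx _).trans ?_
    rw [mul_assoc]
    gcongr
    have h2 : ‖y + t • v - x‖ ≤ r * (1 + ‖v‖) := by
      calc ‖y + t • v - x‖ = ‖(y - x) + t • v‖ := by congr 1; abel
        _ ≤ ‖y - x‖ + t * ‖v‖ := by
          refine (norm_add_le _ _).trans_eq ?_
          rw [norm_smul, Real.norm_of_nonneg ht.le]
        _ ≤ r + r * ‖v‖ := by gcongr
        _ = _ := by ring
    calc ‖y + t • v - x‖ ^ β ≤ (r * (1 + ‖v‖)) ^ β := by gcongr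
      _ = r ^ β * (1 + ‖v‖) ^ β := Real.mul_rpow hr0.le (by positivity)
      _ ≤ r ^ β * (1 + ‖v‖) ^ (1 : ℝ) := by
        gcongr
        linarith [norm_nonneg v]
      _ = _ := by rw [Real.rpow_one]
  have pointwise : ∀ y r, ‖y - x‖ ≤ r → t ≤ r → ∀ v,
      ‖κ v * g (y + t • v)‖ ≤ (B * A * r ^ β) * Φ v := by
    intro y r hy hr v
    have hr0 : 0 < r := ht.trans_le hr
    rw [norm_mul]
    calc ‖κ v‖ * ‖g (y + t • v)‖ ≤ ‖κ v‖ * (A * r ^ β * (1 + ‖v‖)) := by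
          gcongr; exact growth y r hy hr v
      _ = A * r ^ β * ((1 + ‖v‖) * ‖κ v‖) := by ring
      _ ≤ A * r ^ β * (B * Φ v) :=
          mul_le_mul_of_nonneg_left (h0 v) (by positivity)
      _ = _ := by ring
  have hmeas : ∀ y, AEStronglyMeasurable (fun v => g (y + t • v)) (volume : Measure (E d)) :=
    fun y => (hg.comp (by fun_prop)).aestronglyMeasurable
  constructor
  · intro y r hy hr
    refine (norm_integral_le_of_norm_le (hΦi.const_mul _)
      (Filter.Eventually.of_forall (pointwise y r hy hr))).trans_eq ?_
    rw [integral_const_mul]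
    ring
  · intro y hy
    -- a translation of the variable moves the increment from `g` to the kernel
    set w : E d := t⁻¹ • (y - x) with hw
    have hwn : ‖w‖ = ‖y - x‖ / t := by
      rw [hw, norm_smul, norm_inv, Real.norm_of_nonneg ht.le, div_eq_inv_mul]
    have hw1 : ‖w‖ ≤ 1 := by rw [hwn]; exact (div_le_one ht).2 hy
    have hshift : ∀ v, y + t • (v - w) = x + t • v := by
      intro v
      rw [smul_sub, hw, smul_smul, mul_inv_cancel₀ ht.ne', one_smul]
      abel
    have hTy : scaledConv κ t g y = ∫ v, κ (v - w) * g (x + t • v) := by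
      rw [scaledConv, ← integral_sub_right_eq_self _ w]
      simp_rw [hshift]
    have hdiff : ∀ v, ‖(κ (v - w) - κ v) * g (x + t • v)‖ ≤ (B * ‖w‖ * A * t ^ β) * Φ v := by
      intro v
      rw [norm_mul]
      calc ‖κ (v - w) - κ v‖ * ‖g (x + t • v)‖
          ≤ ‖κ (v - w) - κ v‖ * (A * t ^ β * (1 + ‖v‖)) := by
            gcongr; exact growth x t (by simpa using ht.le) le_rfl v
        _ = A * t ^ β * ((1 + ‖v‖) * ‖κ (v - w) - κ v‖) := by ring
        _ ≤ A * t ^ β * (B * ‖w‖ * Φ v) :=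
          mul_le_mul_of_nonneg_left (h1 v w hw1) (by positivity)
        _ = _ := by ring
    have hi0 : Integrable (fun v => κ v * g (x + t • v)) :=
      (hΦi.const_mul _).mono' (κ.continuous.aestronglyMeasurable.mul (hmeas x))
        (Filter.Eventually.of_forall (pointwise x t (by simpa using ht.le) le_rfl))
    have hi1 : Integrable (fun v => (κ (v - w) - κ v) * g (x + t • v)) :=
      (hΦi.const_mul _).mono'
        (AEStronglyMeasurable.mul (Continuous.aestronglyMeasurable (by fun_prop)) (hmeas x))
        (Filter.Eventually.of_forall hdiff)
    have hsub : scaledConv κ t g y - scaledConv κ t g x =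
        ∫ v, (κ (v - w) - κ v) * g (x + t • v) := by
      rw [sub_eq_iff_eq_add, hTy, scaledConv, ← integral_add hi1 hi0]
      congr 1
      ext v
      ring
    rw [hsub]
    refine (norm_integral_le_of_norm_le (hΦi.const_mul _)
      (Filter.Eventually.of_forall hdiff)).trans_eq ?_
    rw [integral_const_mul, hwn]
    ring

theorem exists_scaledConv_bound_of_bounded (κ : 𝓢(E d, ℂ)) : ∃ M : ℝ, 0 ≤ M ∧
    ∀ (t A : ℝ) (g : E d → ℂ), 0 < t → Measurable g → (∀ z, ‖g z‖ ≤ A) →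
      (∀ y, ‖scaledConv κ t g y‖ ≤ M * A) ∧
      (∀ x y, ‖scaledConv κ t g y - scaledConv κ t g x‖ ≤ M * A * (‖y - x‖ / t)) := by
  obtain ⟨M, hM, h⟩ := exists_scaledConv_bound κ
  refine ⟨2 * M, by positivity, fun t A g ht hg hA => ?_⟩
  have hA0 : 0 ≤ A := (norm_nonneg _).trans (hA 0)
  have key := fun x => h t A 0 g x ht hA0 le_rfl zero_le_one hg (by simpa using hA)
  have h1 : ∀ y, ‖scaledConv κ t g y‖ ≤ M * A := fun y => by
    simpa using (key y).1 y t (by simpa using ht.le) le_rfl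
  refine ⟨fun y => (h1 y).trans (by nlinarith [mul_nonneg hM hA0]), fun x y => ?_⟩
  rcases le_total ‖y - x‖ t with hy | hy
  · refine ((key x).2 y hy).trans ?_
    rw [Real.rpow_zero, mul_one]
    gcongr
    linarith
  · have h2 : 1 ≤ ‖y - x‖ / t := (one_le_div ht).2 hy
    calc _ ≤ ‖scaledConv κ t g y‖ + ‖scaledConv κ t g x‖ := norm_sub_le _ _
      _ ≤ 2 * M * A * 1 := by linarith [h1 y, h1 x]
      _ ≤ _ := by gcongr

theorem continuous_of_norm_sub_le {g : E d → ℂ} {C : ℝ} (h : ∀ x y, ‖g y - g x‖ ≤ C * ‖y - x‖) :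
    Continuous g := by
  have h' : LipschitzWith (Real.toNNReal C) g := LipschitzWith.of_dist_le' fun x y => by
    rw [dist_eq_norm, dist_eq_norm]; exact h y x
  exact h'.continuous

theorem continuous_scaledConv (κ : 𝓢(E d, ℂ)) {t A : ℝ} {g : E d → ℂ} (ht : 0 < t)
    (hg : Measurable g) (hA : ∀ z, ‖g z‖ ≤ A) : Continuous (scaledConv κ t g) := by
  obtain ⟨M, _, h⟩ := exists_scaledConv_bound_of_bounded κ
  refine continuous_of_norm_sub_le (C := M * A / t) fun x y => ?_
  exact ((h t A g ht hg hA).2 x y).trans_eq (by ring)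

theorem integrable_scaledConv (κ : 𝓢(E d, ℂ)) {t A : ℝ} {g : E d → ℂ}
    (hg : Measurable g) (hA : ∀ z, ‖g z‖ ≤ A) (x : E d) :
    Integrable (fun v => κ v * g (x + t • v)) :=
  κ.integrable.mul_bdd (c := A) (hg.comp (by fun_prop)).aestronglyMeasurable
    (Filter.Eventually.of_forall fun _ => hA _)

theorem scaledConv_sub_sum (κ : 𝓢(E d, ℂ)) {t : ℝ} {ι : Type*} (s : Finset ι) {c : ι → ℂ}
    {g₀ : E d → ℂ} {g : ι → E d → ℂ} (hg₀ : Continuous g₀) (hA₀ : ∃ A, ∀ z, ‖g₀ z‖ ≤ A)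
    (hg : ∀ i ∈ s, Continuous (g i)) (hA : ∀ i ∈ s, ∃ A, ∀ z, ‖g i z‖ ≤ A) (x : E d) :
    scaledConv κ t (fun z => g₀ z - ∑ i ∈ s, c i * g i z) x =
      scaledConv κ t g₀ x - ∑ i ∈ s, c i * scaledConv κ t (g i) x := by
  obtain ⟨A₀, hA₀⟩ := hA₀
  simp only [scaledConv]
  have hi : ∀ i ∈ s, Integrable (fun v => c i * (κ v * g i (x + t • v))) := by
    intro i hi
    obtain ⟨A, hA⟩ := hA i hi
    exact (integrable_scaledConv κ (hg i hi).measurable hA x).const_mul _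
  simp_rw [← integral_const_mul]
  rw [← integral_finsetSum s hi,
    ← integral_sub (integrable_scaledConv κ hg₀.measurable hA₀ x) (integrable_finsetSum s hi)]
  congr 1
  ext v
  rw [mul_sub, Finset.mul_sum]
  congr 1
  exact Finset.sum_congr rfl fun i _ => by ring

/-- A multiplier acts on constants through the value of its symbol at `0`. -/
theorem scaledConv_fourier_one (a : 𝓢(E d, ℂ)) (t : ℝ) (x : E d) :
    scaledConv (𝓕 a) t (fun _ => 1) x = a 0 := by
  have h : 𝓕⁻ (𝓕 a) 0 = a 0 := by rw [fourierInv_fourier_eq]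
  rw [SchwartzMap.fourierInv_coe, Real.fourierInv_eq] at h
  simpa [scaledConv] using h

/-! ### Dyadic sums -/

theorem summable_pow_natAbs {r : ℝ} (h0 : 0 ≤ r) (h1 : r < 1) :
    Summable fun n : ℤ => r ^ n.natAbs :=
  Summable.of_nat_of_neg (by simpa using summable_geometric_of_lt_one h0 h1)
    (by simpa using summable_geometric_of_lt_one h0 h1)

/-- Dyadic summation: a sequence that is controlled by a negative power of `2 ^ k h` at the
frequencies `2 ^ k ≥ 1 / h` and by a positive power of it at the frequencies `2 ^ k ≤ 1 / h` has a
sum bounded uniformly in `h`. -/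
theorem exists_dyadic_sum_bound {a b : ℝ} (ha : 0 < a) (hb : 0 < b) : ∃ C : ℝ, 0 ≤ C ∧
    ∀ (h K : ℝ) (τ : ℕ → ℝ), 0 < h → 0 ≤ K → (∀ k, 0 ≤ τ k) →
      (∀ k, 1 ≤ (2 : ℝ) ^ k * h → τ k ≤ K * ((2 : ℝ) ^ k * h) ^ (-a)) →
      (∀ k, (2 : ℝ) ^ k * h ≤ 1 → τ k ≤ K * ((2 : ℝ) ^ k * h) ^ b) →
      Summable τ ∧ ∑' k, τ k ≤ C * K := by
  set c := min a b with hc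
  have hc0 : 0 < c := lt_min ha hb
  set r : ℝ := 2 ^ (-c) with hr
  have hr0 : 0 < r := by positivity
  have hr1 : r < 1 := Real.rpow_lt_one_of_one_lt_of_neg one_lt_two (by linarith)
  have hs := summable_pow_natAbs hr0.le hr1
  refine ⟨2 ^ c * ∑' n : ℤ, r ^ n.natAbs,
    mul_nonneg (by positivity) (tsum_nonneg fun _ => by positivity), ?_⟩
  intro h K τ hh hK hτ hlarge hsmall
  -- `2 ^ p` is comparable to `1 / h`, so the `k`-th term decays geometrically in `|k - p|`
  obtain ⟨p, hp1, hp2⟩ := exists_mem_Ico_zpow (inv_pos.2 hh) (one_lt_two (α := ℝ))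
  have hup : ∀ k : ℕ, (2 : ℝ) ^ k * h ≤ 2 ^ ((k : ℤ) - p) := by
    intro k
    rw [zpow_sub₀ two_ne_zero, zpow_natCast, div_eq_mul_inv]
    gcongr
    exact (le_inv_comm₀ (by positivity) hh).1 hp1
  have hlow : ∀ k : ℕ, (2 : ℝ) ^ ((k : ℤ) - p - 1) < 2 ^ k * h := by
    intro k
    rw [sub_sub, zpow_sub₀ two_ne_zero, zpow_natCast, div_eq_mul_inv]
    gcongr
    exact (inv_lt_comm₀ hh (by positivity)).1 hp2
  have hpow : ∀ n : ℕ, r ^ n = (2 : ℝ) ^ (-(c * n)) := by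
    intro n
    rw [hr, ← Real.rpow_natCast, ← Real.rpow_mul two_pos.le]
    congr 1
    ring
  have key : ∀ k : ℕ, τ k ≤ K * (2 ^ c * r ^ ((k : ℤ) - p).natAbs) := by
    intro k
    have hpos : 0 < (2 : ℝ) ^ k * h := by positivity
    rcases le_total 1 ((2 : ℝ) ^ k * h) with h1 | h1
    · refine (hlarge k h1).trans ?_
      gcongr
      have hkp : 0 ≤ (k : ℤ) - p := by
        by_contra hneg
        push Not at hneg
        exact absurd (h1.trans (hup k)) (not_le.2 (zpow_lt_one_of_neg₀ one_lt_two hneg))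
      obtain ⟨n, hn⟩ := Int.eq_ofNat_of_zero_le hkp
      have hl := hlow k
      rw [hn] at hl ⊢
      calc ((2 : ℝ) ^ k * h) ^ (-a) ≤ ((2 : ℝ) ^ k * h) ^ (-c) :=
            Real.rpow_le_rpow_of_exponent_le h1 (by simp [hc])
        _ ≤ ((2 : ℝ) ^ ((n : ℤ) - 1)) ^ (-c) :=
            Real.rpow_le_rpow_of_nonpos (by positivity) hl.le (by linarith)
        _ = 2 ^ c * r ^ n := by
            rw [hpow, ← Real.rpow_intCast, ← Real.rpow_mul two_pos.le, ← Real.rpow_add two_pos]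
            congr 1
            push_cast
            ring
    · refine (hsmall k h1).trans ?_
      gcongr
      have hkp : (k : ℤ) - p - 1 < 0 := by
        by_contra hneg
        push Not at hneg
        exact absurd ((hlow k).trans_le h1) (not_lt.2 (one_le_zpow₀ one_le_two hneg))
      obtain ⟨n, hn⟩ := Int.eq_ofNat_of_zero_le (show 0 ≤ -((k : ℤ) - p) by omega)
      have hl := hup k
      have habs : ((k : ℤ) - p).natAbs = n := by omega
      rw [show (k : ℤ) - p = -(n : ℤ) by omega] at hl
      rw [habs]
      calc ((2 : ℝ) ^ k * h) ^ b ≤ ((2 : ℝ) ^ k * h) ^ c :=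
            Real.rpow_le_rpow_of_exponent_ge hpos h1 (by simp [hc])
        _ ≤ ((2 : ℝ) ^ (-(n : ℤ))) ^ c := Real.rpow_le_rpow hpos.le hl hc0.le
        _ = 1 * r ^ n := by
            rw [hpow, ← Real.rpow_intCast, ← Real.rpow_mul two_pos.le, one_mul]
            congr 1
            push_cast
            ring
        _ ≤ 2 ^ c * r ^ n := by
            gcongr
            exact Real.one_le_rpow one_le_two hc0.le
  have hinj : Function.Injective fun k : ℕ => (k : ℤ) - p := fun i j hij => by
    simpa using hij
  have hs' : Summable fun k : ℕ => r ^ ((k : ℤ) - p).natAbs := hs.comp_injective hinj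
  have hsum : Summable fun k : ℕ => K * (2 ^ c * r ^ ((k : ℤ) - p).natAbs) :=
    (hs'.mul_left _).mul_left _
  have hτs : Summable τ := Summable.of_nonneg_of_le hτ key hsum
  refine ⟨hτs, (hτs.tsum_le_tsum key hsum).trans ?_⟩
  rw [tsum_mul_left, tsum_mul_left, mul_comm]
  gcongr
  exact tsum_comp_le_tsum_of_inj hs (fun _ => by positivity) hinj

/-! ### Paraproducts of functions -/

/-- The function `∑_{j < k - 1} Δ_j g` (indices shifted by one), for a bounded function `g` and for
the kernel `κ` of `IsDyadicPartition.lowKernel`; see `IsDyadicPartition.sum_toFun_block`. It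
vanishes for `k < 2`, where the sum is empty. -/
def lowPart (κ : 𝓢(E d, ℂ)) (k : ℕ) (g : E d → ℂ) (x : E d) : ℂ :=
  if k < 2 then 0 else scaledConv κ ((2 : ℝ) ^ k)⁻¹ g x

/-- The paraproduct of the function `g` with the function `∑ₖ bₖ`, as a pointwise series. -/
def paraSum (κ : 𝓢(E d, ℂ)) (g : E d → ℂ) (b : ℕ → E d → ℂ) (x : E d) : ℂ :=
  ∑' k, lowPart κ k g x * b k x

/-- The size and Lipschitz bounds satisfied by the Littlewood–Paley blocks `b k` (index shifted by
one) of a function of regularity `α` and size `N`. -/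
structure IsBlockSeq (b : ℕ → E d → ℂ) (α N : ℝ) : Prop where
  norm_le : ∀ k x, ‖b k x‖ ≤ N * ((2 : ℝ) ^ k) ^ (-α)
  norm_sub_le : ∀ k x y, ‖b k y - b k x‖ ≤ N * ((2 : ℝ) ^ k) ^ (-α) * ((2 : ℝ) ^ k * ‖y - x‖)

theorem summable_two_pow_rpow_neg {α : ℝ} (hα : 0 < α) :
    Summable fun k : ℕ => ((2 : ℝ) ^ k) ^ (-α) := by
  have h : ∀ k : ℕ, ((2 : ℝ) ^ k) ^ (-α) = (2 ^ (-α)) ^ k := fun k => by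
    rw [← Real.rpow_natCast, ← Real.rpow_natCast, ← Real.rpow_mul two_pos.le,
      ← Real.rpow_mul two_pos.le, mul_comm]
  simp_rw [h]
  exact summable_geometric_of_lt_one (by positivity)
    (Real.rpow_lt_one_of_one_lt_of_neg one_lt_two (by linarith))

theorem IsBlockSeq.continuous {b : ℕ → E d → ℂ} {α N : ℝ} (hb : IsBlockSeq b α N) (k : ℕ) :
    Continuous (b k) :=
  continuous_of_norm_sub_le (C := N * ((2 : ℝ) ^ k) ^ (-α) * (2 : ℝ) ^ k) fun x y =>
    (hb.norm_sub_le k x y).trans_eq (by ring)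

theorem IsBlockSeq.nonneg {b : ℕ → E d → ℂ} {α N : ℝ} (hb : IsBlockSeq b α N) : 0 ≤ N := by
  simpa using (norm_nonneg _).trans (hb.norm_le 0 0)

theorem exists_lowPart_bound (κ : 𝓢(E d, ℂ)) : ∃ M : ℝ, 0 ≤ M ∧
    ∀ (A : ℝ) (g : E d → ℂ), Continuous g → (∀ z, ‖g z‖ ≤ A) →
      ∀ k, Continuous (lowPart κ k g) ∧ ∀ x, ‖lowPart κ k g x‖ ≤ M * A := by
  obtain ⟨M, hM, h⟩ := exists_scaledConv_bound_of_bounded κ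
  refine ⟨M, hM, fun A g hg hA k => ?_⟩
  have hA0 : 0 ≤ A := (norm_nonneg _).trans (hA 0)
  by_cases hk : k < 2
  · have : lowPart κ k g = fun _ => 0 := by ext x; simp [lowPart, hk]
    rw [this]
    exact ⟨continuous_const, fun x => by simpa using mul_nonneg hM hA0⟩
  · have : lowPart κ k g = scaledConv κ ((2 : ℝ) ^ k)⁻¹ g := by ext x; simp [lowPart, hk]
    rw [this]
    exact ⟨continuous_scaledConv κ (by positivity) hg.measurable hA,
      (h _ A g (by positivity) hg.measurable hA).1⟩

theorem exists_paraSum_bound (κ : 𝓢(E d, ℂ)) {α : ℝ} (hα : 0 < α) : ∃ M : ℝ, 0 ≤ M ∧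
    ∀ (A N : ℝ) (g : E d → ℂ) (b : ℕ → E d → ℂ), Continuous g → (∀ z, ‖g z‖ ≤ A) →
      IsBlockSeq b α N →
      (∀ k x, ‖lowPart κ k g x * b k x‖ ≤ M * A * N * ((2 : ℝ) ^ k) ^ (-α)) ∧
      Continuous (paraSum κ g b) ∧ ∀ x, ‖paraSum κ g b x‖ ≤ M * A * N := by
  obtain ⟨M, hM, h⟩ := exists_lowPart_bound κ
  have hs := summable_two_pow_rpow_neg hα
  set Z := ∑' k : ℕ, ((2 : ℝ) ^ k) ^ (-α) with hZ
  have hZ1 : 1 ≤ Z := by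
    simpa using hs.le_tsum 0 (fun _ _ => by positivity)
  refine ⟨M * Z, by positivity, fun A N g b hg hA hb => ?_⟩
  have hA0 : 0 ≤ A := (norm_nonneg _).trans (hA 0)
  have hN0 := hb.nonneg
  have h1 : ∀ k x, ‖lowPart κ k g x * b k x‖ ≤ M * A * N * ((2 : ℝ) ^ k) ^ (-α) := by
    intro k x
    rw [norm_mul, mul_assoc (M * A)]
    exact mul_le_mul ((h A g hg hA k).2 x) (hb.norm_le k x) (norm_nonneg _) (by positivity)
  refine ⟨fun k x => (h1 k x).trans ?_, ?_, fun x => ?_⟩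
  · gcongr
    exact le_mul_of_one_le_right hM hZ1
  · exact continuous_tsum (fun k => (h A g hg hA k).1.mul (hb.continuous k)) (hs.mul_left _) h1
  · refine (tsum_of_norm_bounded (hs.hasSum.mul_left _) (fun k => h1 k x)).trans_eq ?_
    ring

/-- The regularity gained by a paraproduct: if `g` vanishes at order `β` at `x` and `b` has
regularity `α`, with `α + β < 1`, then `paraSum κ g b` minus its value at `x` vanishes at order
`α + β` at `x`. At the frequencies `2 ^ k ≥ 1 / ‖y - x‖` the two terms of the increment are
estimated separately, and at lower frequencies the Lipschitz bounds are used; `α > 0` makes the sum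
over the former converge and `α + β < 1` the sum over the latter. -/
theorem exists_paraSum_sub_bound (κ : 𝓢(E d, ℂ)) {α β : ℝ} (hα : 0 < α) (hβ : 0 ≤ β)
    (hαβ : β + α < 1) : ∃ C : ℝ, 0 ≤ C ∧
    ∀ (A N : ℝ) (g : E d → ℂ) (b : ℕ → E d → ℂ) (x : E d), Continuous g → (∃ B, ∀ z, ‖g z‖ ≤ B) →
      0 ≤ A → (∀ z, ‖g z‖ ≤ A * ‖z - x‖ ^ β) → IsBlockSeq b α N →
      ∀ y, ‖paraSum κ g b y - paraSum κ g b x‖ ≤ C * (A * N * ‖y - x‖ ^ (β + α)) := by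
  obtain ⟨M, hM, hconv⟩ := exists_scaledConv_bound κ
  obtain ⟨C, hC, hsum⟩ := exists_dyadic_sum_bound (a := α) (b := 1 - (β + α)) hα (by linarith)
  obtain ⟨M', _, hps⟩ := exists_paraSum_bound κ hα
  refine ⟨C * (2 * M), by positivity, fun A N g b x hg hbd hA hgx hb y => ?_⟩
  have hN := hb.nonneg
  obtain ⟨B, hB⟩ := hbd
  rcases eq_or_ne y x with rfl | hyx
  · simp only [sub_self, norm_zero]
    positivity
  set h := ‖y - x‖ with hh
  have hh0 : 0 < h := norm_pos_iff.2 (sub_ne_zero.2 hyx)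
  have hsummable : ∀ x, Summable fun k => lowPart κ k g x * b k x := fun x =>
    Summable.of_norm_bounded ((summable_two_pow_rpow_neg hα).mul_left _)
      fun k => (hps B N g b hg hB hb).1 k x
  have key := hsum h (2 * M * (A * N * h ^ (β + α)))
    (fun k => ‖lowPart κ k g y * b k y - lowPart κ k g x * b k x‖) hh0 (by positivity)
    (fun _ => norm_nonneg _) ?_ ?_
  · rw [paraSum, paraSum, ← (hsummable y).tsum_sub (hsummable x)]
    exact (norm_tsum_le_tsum_norm key.1).trans (key.2.trans_eq (by ring))
  · intro k hk
    by_cases hk2 : k < 2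
    · simp only [lowPart, hk2, if_true, zero_mul, sub_self, norm_zero]
      positivity
    set D := (2 : ℝ) ^ k with hD
    have hD0 : 0 < D := by positivity
    have hDh : D⁻¹ ≤ h := by rwa [inv_le_iff_one_le_mul₀' hD0]
    have hc := (hconv D⁻¹ A β g x (by positivity) hA hβ (by linarith) hg.measurable hgx).1
    simp only [lowPart, hk2, if_false]
    have e : (D * h) ^ (-α) = D ^ (-α) * h ^ (-α) := Real.mul_rpow hD0.le hh0.le
    have e2 : h ^ (β + α) * h ^ (-α) = h ^ β := by rw [← Real.rpow_add hh0]; congr 1; ring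
    calc ‖scaledConv κ D⁻¹ g y * b k y - scaledConv κ D⁻¹ g x * b k x‖
        ≤ ‖scaledConv κ D⁻¹ g y‖ * ‖b k y‖ + ‖scaledConv κ D⁻¹ g x‖ * ‖b k x‖ := by
          rw [← norm_mul, ← norm_mul]; exact norm_sub_le _ _
      _ ≤ M * A * h ^ β * (N * D ^ (-α)) + M * A * h ^ β * (N * D ^ (-α)) := by
          gcongr
          · exact hc y h le_rfl hDh
          · exact hb.norm_le k y
          · exact hc x h (by simpa using hh0.le) hDh
          · exact hb.norm_le k x
      _ = 2 * M * (A * N * (h ^ (β + α) * h ^ (-α))) * D ^ (-α) := by rw [e2]; ring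
      _ = _ := by rw [e]; ring
  · intro k hk
    by_cases hk2 : k < 2
    · simp only [lowPart, hk2, if_true, zero_mul, sub_self, norm_zero]
      positivity
    set D := (2 : ℝ) ^ k with hD
    have hD0 : 0 < D := by positivity
    have hDh : h ≤ D⁻¹ := by rwa [le_inv_comm₀ hh0 hD0, inv_eq_one_div, le_div_iff₀ hh0]
    have hc := hconv D⁻¹ A β g x (by positivity) hA hβ (by linarith) hg.measurable hgx
    simp only [lowPart, hk2, if_false]
    have e : D⁻¹ ^ β = D ^ (-β) := by rw [Real.inv_rpow hD0.le, Real.rpow_neg hD0.le]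
    have e2 : h ^ (β + α) * (D * h) ^ (1 - (β + α)) = D ^ (-β) * D ^ (-α) * (D * h) := by
      rw [Real.mul_rpow hD0.le hh0.le, mul_left_comm, ← Real.rpow_add hh0, ← Real.rpow_add hD0]
      rw [show β + α + (1 - (β + α)) = 1 by ring, Real.rpow_one,
        show 1 - (β + α) = (-β + -α) + 1 by ring, Real.rpow_add_one hD0.ne']
      ring
    calc ‖scaledConv κ D⁻¹ g y * b k y - scaledConv κ D⁻¹ g x * b k x‖
        = ‖(scaledConv κ D⁻¹ g y - scaledConv κ D⁻¹ g x) * b k y +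
            scaledConv κ D⁻¹ g x * (b k y - b k x)‖ := by congr 1; ring
      _ ≤ ‖scaledConv κ D⁻¹ g y - scaledConv κ D⁻¹ g x‖ * ‖b k y‖ +
            ‖scaledConv κ D⁻¹ g x‖ * ‖b k y - b k x‖ := by
          rw [← norm_mul, ← norm_mul]; exact norm_add_le _ _
      _ ≤ M * A * (h / D⁻¹ * D⁻¹ ^ β) * (N * D ^ (-α)) +
            M * A * D⁻¹ ^ β * (N * D ^ (-α) * (D * h)) := by
          gcongr
          · exact hc.2 y hDh
          · exact hb.norm_le k y
          · exact hc.1 x _ (by simpa using hD0.le) le_rfl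
          · exact hb.norm_sub_le k x y
      _ = 2 * M * (A * N * (D ^ (-β) * D ^ (-α) * (D * h))) := by
          rw [e, div_inv_eq_mul]; ring
      _ = _ := by rw [← e2]; ring

theorem paraSum_sub_sum (κ : 𝓢(E d, ℂ)) {α N : ℝ} (hα : 0 < α) {b : ℕ → E d → ℂ}
    (hb : IsBlockSeq b α N) {ι : Type*} (s : Finset ι) {c : ι → ℂ}
    {g₀ : E d → ℂ} {g : ι → E d → ℂ} (hg₀ : Continuous g₀) (hA₀ : ∃ A, ∀ z, ‖g₀ z‖ ≤ A)
    (hg : ∀ i ∈ s, Continuous (g i)) (hA : ∀ i ∈ s, ∃ A, ∀ z, ‖g i z‖ ≤ A) (x : E d) :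
    paraSum κ (fun z => g₀ z - ∑ i ∈ s, c i * g i z) b x =
      paraSum κ g₀ b x - ∑ i ∈ s, c i * paraSum κ (g i) b x := by
  obtain ⟨M, _, hM⟩ := exists_paraSum_bound (d := d) κ hα
  have hsum : ∀ g : E d → ℂ, Continuous g → (∃ A, ∀ z, ‖g z‖ ≤ A) →
      Summable fun k => lowPart κ k g x * b k x := fun g hg ⟨A, hA⟩ =>
    Summable.of_norm_bounded ((summable_two_pow_rpow_neg hα).mul_left _)
      fun k => (hM A N g b hg hA hb).1 k x
  have hs : ∀ i ∈ s, Summable fun k => c i * (lowPart κ k (g i) x * b k x) := fun i hi =>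
    (hsum (g i) (hg i hi) (hA i hi)).mul_left _
  simp only [paraSum]
  simp_rw [← tsum_mul_left]
  rw [← Summable.tsum_finsetSum hs, ← (hsum g₀ hg₀ hA₀).tsum_sub (summable_sum hs)]
  congr 1
  ext k
  by_cases hk : k < 2
  · simp [lowPart, hk]
  · simp only [lowPart, hk, if_false]
    rw [scaledConv_sub_sum κ s hg₀ hA₀ hg hA, sub_mul, Finset.sum_mul]
    simp only [mul_assoc]

/-- The paraproduct with the constant `1` only loses the two lowest blocks. -/
theorem paraSum_one (κ : 𝓢(E d, ℂ)) (hκ : ∀ t x, scaledConv κ t (fun _ => 1) x = 1)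
    {α N : ℝ} (hα : 0 < α) {b : ℕ → E d → ℂ} (hb : IsBlockSeq b α N) (x : E d) :
    ∑' k, b k x = paraSum κ (fun _ => 1) b x + (b 0 x + b 1 x) := by
  have hs : Summable fun k => b k x :=
    Summable.of_norm_bounded ((summable_two_pow_rpow_neg hα).mul_left _) fun k => hb.norm_le k x
  have hlow : ∀ k, lowPart κ k (fun _ => 1) x * b k x = if k < 2 then 0 else b k x := by
    intro k
    by_cases hk : k < 2 <;> simp [lowPart, hk, hκ]
  have hs' : Summable fun k => lowPart κ k (fun _ => 1) x * b k x := by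
    rw [← summable_nat_add_iff 2] at hs ⊢
    simpa [hlow] using hs
  rw [paraSum, ← hs.sum_add_tsum_nat_add 2, ← hs'.sum_add_tsum_nat_add 2]
  simp [hlow, Finset.sum_range_succ]
  ring

/-! ### Increments of words -/

variable {ι : Type*}

open Classical in
/-- The increment `ω_{yx}`, with the value `1` (instead of `0`) at the empty word. With this
convention the term `ℓ = k` of the defining recursion is `F^{i₁…i_k}(x)`, see
`extIncrement_eq`. -/
def extIncrement {X : Type*} (F : List ι → X → ℂ) (y x : X) (w : List ι) : ℂ :=
  if w = [] then 1 else increment F y x w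

theorem extIncrement_nil {X : Type*} (F : List ι → X → ℂ) (y x : X) :
    extIncrement F y x [] = 1 := if_pos rfl

theorem extIncrement_of_ne_nil {X : Type*} (F : List ι → X → ℂ) (y x : X) {w : List ι}
    (hw : w ≠ []) : extIncrement F y x w = increment F y x w := if_neg hw

theorem extIncrement_eq {X : Type*} (F : List ι → X → ℂ) (y x : X) {w : List ι} (hw : w ≠ []) :
    extIncrement F y x w = F w y - ∑ l ∈ Finset.range w.length,
      F (w.take (l + 1)) x * extIncrement F y x (w.drop (l + 1)) := by
  have hlen : 0 < w.length := List.length_pos_iff.2 hw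
  have hsum : ∑ l : Fin (w.length - 1), F (w.take (l + 1)) x * increment F y x (w.drop (l + 1)) =
      ∑ l ∈ Finset.range (w.length - 1),
        F (w.take (l + 1)) x * extIncrement F y x (w.drop (l + 1)) := by
    rw [← Fin.sum_univ_eq_sum_range
      (fun l => F (w.take (l + 1)) x * extIncrement F y x (w.drop (l + 1)))]
    refine Finset.sum_congr rfl fun l _ => ?_
    have := l.isLt
    rw [extIncrement_of_ne_nil]
    rw [Ne, List.drop_eq_nil_iff]
    omega
  rw [extIncrement_of_ne_nil F y x hw, increment, hsum]
  obtain ⟨m, hm⟩ : ∃ m, w.length = m + 1 := ⟨w.length - 1, by omega⟩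
  rw [show w.length - 1 = m by omega, hm, Finset.sum_range_succ, List.take_of_length_le hm.le,
    List.drop_of_length_le hm.le, extIncrement_nil]
  ring

theorem increment_self {X : Type*} (F : List ι → X → ℂ) (x : X) (w : List ι) :
    increment F x x w = 0 := by
  induction h : w.length using Nat.strong_induction_on generalizing w with
  | _ n ih =>
    rw [increment]
    have : ∀ i : Fin (w.length - 1), increment F x x (w.drop (i + 1)) = 0 := fun i =>
      ih _ (by have := i.isLt; simp only [List.length_drop]; omega) _ rfl
    simp [this]

theorem increment_congr {X : Type*} {F G : List ι → X → ℂ} (h : ∀ w ≠ [], F w = G w) (y x : X)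
    {w : List ι} (hw : w ≠ []) : increment F y x w = increment G y x w := by
  induction hn : w.length using Nat.strong_induction_on generalizing w with
  | _ n ih =>
    rw [increment, increment, h w hw]
    congr 1
    refine Finset.sum_congr rfl fun i _ => ?_
    have := i.isLt
    rw [h (w.take (i + 1)) (by simp [hw]), ih _ _ _ rfl]
    · simp only [List.length_drop]; omega
    · rw [Ne, List.drop_eq_nil_iff]; omega

theorem increment_map {ι' X : Type*} (F : List ι' → X → ℂ) (f : ι → ι') (y x : X) (w : List ι) :
    increment F y x (w.map f) = increment (fun v => F (v.map f)) y x w := by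
  induction hn : w.length using Nat.strong_induction_on generalizing w with
  | _ n ih =>
    rw [increment, increment]
    congr 1
    rw [← Fin.sum_congr' _ (show w.length - 1 = (w.map f).length - 1 by simp)]
    refine Finset.sum_congr rfl fun i _ => ?_
    have := i.isLt
    simp only [Fin.val_cast]
    rw [← List.map_take, ← List.map_drop, ih _ _ _ rfl]
    simp only [List.length_drop]; omega

/-! ### Increments of iterated paraproducts -/

/-- The functions `F w` are iterated paraproducts, in the pointwise sense, of the letters with
blocks `b i`. The value at the empty word is `1`, which makes `F [i]` the paraproduct of `F []` with
`b i`, up to the two lowest blocks (`paraSum_one`). -/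
structure IsParaModel (κ : 𝓢(E d, ℂ)) (α N : ι → ℝ) (b : ι → ℕ → E d → ℂ)
    (F : List ι → E d → ℂ) : Prop where
  blocks : ∀ i, IsBlockSeq (b i) (α i) (N i)
  nil : F [] = fun _ => 1
  single : ∀ i x, F [i] x = ∑' k, b i k x
  concat : ∀ w i, w ≠ [] → F (w ++ [i]) = paraSum κ (F w) (b i)

section
variable {κ : 𝓢(E d, ℂ)} (hκ : ∀ t x, scaledConv κ t (fun _ => 1) x = 1) {α : ι → ℝ}
  (hα : ∀ i, 0 < α i)
include hα

theorem exists_isParaModel_bound (κ : 𝓢(E d, ℂ)) (w : List ι) :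
    ∃ K : ℝ, 0 ≤ K ∧ ∀ N b F, IsParaModel κ α N b F →
      Continuous (F w) ∧ ∀ x, ‖F w x‖ ≤ K * (w.map N).prod := by
  induction w using List.reverseRecOn with
  | nil =>
    refine ⟨1, zero_le_one, fun N b F h => ?_⟩
    rw [h.nil]
    exact ⟨continuous_const, fun x => by simp⟩
  | append_singleton w i ih =>
    by_cases hw : w = []
    · subst hw
      have hs := summable_two_pow_rpow_neg (hα i)
      refine ⟨∑' k : ℕ, ((2 : ℝ) ^ k) ^ (-α i), tsum_nonneg fun _ => by positivity,
        fun N b F h => ?_⟩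
      have hF : F ([] ++ [i]) = fun x => ∑' k, b i k x := funext fun x => h.single i x
      rw [hF]
      refine ⟨continuous_tsum (h.blocks i).continuous (hs.mul_left (N i)) (h.blocks i).norm_le,
        fun x => ?_⟩
      refine (tsum_of_norm_bounded (hs.hasSum.mul_left _)
        (fun k => (h.blocks i).norm_le k x)).trans_eq ?_
      simp [mul_comm]
    · obtain ⟨K, hK, ih⟩ := ih
      obtain ⟨M, hM, hp⟩ := exists_paraSum_bound κ (hα i)
      refine ⟨M * K, by positivity, fun N b F h => ?_⟩
      rw [h.concat w i hw]
      have h1 := ih N b F h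
      have h2 := (hp _ _ _ _ h1.1 h1.2 (h.blocks i)).2
      refine ⟨h2.1, fun x => (h2.2 x).trans_eq ?_⟩
      simp
      ring

theorem exists_extIncrement_bound (κ : 𝓢(E d, ℂ)) (w : List ι) :
    ∃ K : ℝ, 0 ≤ K ∧ ∀ N b F, IsParaModel κ α N b F → ∀ x,
      Continuous (fun y => extIncrement F y x w) ∧
        ∀ y, ‖extIncrement F y x w‖ ≤ K * (w.map N).prod := by
  induction hn : w.length using Nat.strong_induction_on generalizing w with
  | _ n ih =>
  by_cases hw : w = []
  · subst hw
    refine ⟨1, zero_le_one, fun N b F _ x => ?_⟩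
    simp only [extIncrement_nil]
    exact ⟨continuous_const, fun y => by simp⟩
  have ih' : ∀ l : ℕ, ∃ K : ℝ, 0 ≤ K ∧ ∀ N b F, IsParaModel κ α N b F →
      ∀ x, Continuous (fun y => extIncrement F y x (w.drop (l + 1))) ∧
        ∀ y, ‖extIncrement F y x (w.drop (l + 1))‖ ≤ K * ((w.drop (l + 1)).map N).prod :=
    fun l => ih _ (by
      have := List.length_pos_iff.2 hw
      simp only [List.length_drop]; omega) _ rfl
  choose K hK ih' using ih'
  choose M hM hF using exists_isParaModel_bound hα κ
  refine ⟨M w + ∑ l ∈ Finset.range w.length, M (w.take (l + 1)) * K l,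
    add_nonneg (hM w) (Finset.sum_nonneg fun l _ => mul_nonneg (hM _) (hK l)),
    fun N b F h x => ?_⟩
  have hN : ∀ v : List ι, 0 ≤ (v.map N).prod := fun v =>
    List.prod_nonneg fun a ha => by
      obtain ⟨i, _, rfl⟩ := List.mem_map.1 ha
      exact (h.blocks i).nonneg
  simp only [extIncrement_eq F _ x hw]
  refine ⟨(hF w N b F h).1.sub (continuous_finsetSum _ fun l _ =>
    continuous_const.mul (ih' l N b F h x).1), fun y => ?_⟩
  refine (norm_sub_le _ _).trans ?_
  rw [add_mul, Finset.sum_mul]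
  refine add_le_add ((hF w N b F h).2 y) ((norm_sum_le _ _).trans (Finset.sum_le_sum fun l _ => ?_))
  rw [norm_mul]
  have hprod : (w.map N).prod = ((w.take (l + 1)).map N).prod * ((w.drop (l + 1)).map N).prod := by
    rw [List.map_take, List.map_drop, List.prod_take_mul_prod_drop]
  rw [hprod, mul_mul_mul_comm]
  exact mul_le_mul ((hF _ N b F h).2 x) ((ih' l N b F h x).2 y) (norm_nonneg _)
    (mul_nonneg (hM _) (hN _))

include hκ

/-- As a function of `y`, the increment of the word `w i` is the paraproduct of the increment of `w`
with the letter `i`, up to a constant and a multiple of the two lowest blocks of `i`. Both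
recursions, for increments and for iterated paraproducts, are linear with coefficients depending on
`x` only, and only the words `[j]` create low frequency terms (`paraSum_one`). -/
theorem exists_extIncrement_concat (w : List ι) (i : ι) :
    ∃ K : ℝ, 0 ≤ K ∧ ∀ N b F, IsParaModel κ α N b F → ∀ x, ∃ c c' : ℂ,
      ‖c‖ ≤ K * (w.map N).prod ∧ ∀ y, extIncrement F y x (w ++ [i]) =
        paraSum κ (fun z => extIncrement F z x w) (b i) y + c * (b i 0 y + b i 1 y) + c' := by
  induction hn : w.length using Nat.strong_induction_on generalizing w with
  | _ n ih =>
  by_cases hw : w = []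
  · subst hw
    refine ⟨1, zero_le_one, fun N b F h x => ⟨1, -F [i] x, by simp, fun y => ?_⟩⟩
    rw [extIncrement_eq F y x (by simp)]
    simp only [extIncrement_nil, List.nil_append]
    rw [h.single i y, paraSum_one κ hκ (hα i) (h.blocks i)]
    simp [extIncrement_nil]
    ring
  have hlen := List.length_pos_iff.2 hw
  have ih' := fun l : ℕ => ih (w.drop (l + 1)).length (by simp only [List.length_drop]; omega)
    (w.drop (l + 1)) rfl
  choose K hK ih' using ih'
  choose M hM hF using exists_isParaModel_bound hα κ
  choose M' hM' hI using exists_extIncrement_bound hα κ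
  refine ⟨∑ l ∈ Finset.range w.length, M (w.take (l + 1)) * K l,
    Finset.sum_nonneg fun l _ => mul_nonneg (hM _) (hK l), fun N b F h x => ?_⟩
  have hN : ∀ v : List ι, 0 ≤ (v.map N).prod := fun v =>
    List.prod_nonneg fun a ha => by
      obtain ⟨i, _, rfl⟩ := List.mem_map.1 ha
      exact (h.blocks i).nonneg
  choose c c' hc heq using fun l => ih' l N b F h x
  refine ⟨-∑ l ∈ Finset.range w.length, F (w.take (l + 1)) x * c l,
    -(∑ l ∈ Finset.range w.length, F (w.take (l + 1)) x * c' l) - F (w ++ [i]) x, ?_, fun y => ?_⟩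
  · rw [norm_neg, Finset.sum_mul]
    refine (norm_sum_le _ _).trans (Finset.sum_le_sum fun l _ => ?_)
    rw [norm_mul]
    have hprod : (w.map N).prod =
        ((w.take (l + 1)).map N).prod * ((w.drop (l + 1)).map N).prod := by
      rw [List.map_take, List.map_drop, List.prod_take_mul_prod_drop]
    rw [hprod, mul_mul_mul_comm]
    exact mul_le_mul ((hF _ N b F h).2 x) (hc l) (norm_nonneg _) (mul_nonneg (hM _) (hN _))
  · rw [extIncrement_eq F y x (by simp), List.length_append, List.length_singleton,
      Finset.sum_range_succ, List.take_of_length_le (by simp), List.drop_of_length_le (by simp),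
      extIncrement_nil, h.concat w i hw]
    have hterm : ∀ l ∈ Finset.range w.length,
        F ((w ++ [i]).take (l + 1)) x * extIncrement F y x ((w ++ [i]).drop (l + 1)) =
        F (w.take (l + 1)) x * paraSum κ (fun z => extIncrement F z x (w.drop (l + 1))) (b i) y +
        (F (w.take (l + 1)) x * c l) * (b i 0 y + b i 1 y) + F (w.take (l + 1)) x * c' l := by
      intro l hl
      have hl' := Finset.mem_range.1 hl
      rw [List.take_append_of_le_length (by omega), List.drop_append_of_le_length (by omega), heq]
      ring
    rw [Finset.sum_congr rfl hterm, Finset.sum_add_distrib, Finset.sum_add_distrib,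
      ← Finset.sum_mul]
    have hps : paraSum κ (fun z => extIncrement F z x w) (b i) y =
        paraSum κ (F w) (b i) y - ∑ l ∈ Finset.range w.length, F (w.take (l + 1)) x *
          paraSum κ (fun z => extIncrement F z x (w.drop (l + 1))) (b i) y := by
      simp only [extIncrement_eq F _ x hw]
      exact paraSum_sub_sum κ (hα i) (h.blocks i) _ (hF w N b F h).1 ⟨_, (hF w N b F h).2⟩
        (fun l _ => (hI _ N b F h x).1) (fun l _ => ⟨_, (hI _ N b F h x).2⟩) y
    rw [hps]
    ring

/-- The local behavior of increments, by induction on the last letter: since increments vanish at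
`y = x`, the decomposition `exists_extIncrement_concat` bounds the increment of `w i` by that of a
paraproduct, to which `exists_paraSum_sub_bound` applies, and by that of two low blocks. -/
theorem exists_extIncrement_holder (w : List ι) (hw : (w.map α).sum < 1) :
    ∃ K : ℝ, 0 ≤ K ∧ ∀ N b F, IsParaModel κ α N b F → ∀ x y,
      ‖extIncrement F y x w‖ ≤ K * (w.map N).prod * ‖y - x‖ ^ (w.map α).sum := by
  induction w using List.reverseRecOn with
  | nil => exact ⟨1, zero_le_one, fun N b F _ x y => by simp [extIncrement_nil]⟩
  | append_singleton w i ih =>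
    have hβ : 0 ≤ (w.map α).sum := List.sum_nonneg fun a ha => by
      obtain ⟨i, _, rfl⟩ := List.mem_map.1 ha
      exact (hα i).le
    have hs : ((w ++ [i]).map α).sum = (w.map α).sum + α i := by simp
    rw [hs] at hw ⊢
    set β := (w.map α).sum with hβd
    obtain ⟨K, hK, ih⟩ := ih (by linarith [hα i])
    obtain ⟨C, hC, hps⟩ := exists_paraSum_sub_bound κ (hα i) hβ hw
    obtain ⟨Q, hQ, hcc⟩ := exists_extIncrement_concat hκ hα w i
    obtain ⟨M', hM', hI⟩ := exists_extIncrement_bound hα κ w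
    refine ⟨C * K + Q * 4, by positivity, fun N b F h x y => ?_⟩
    have hN : 0 ≤ (w.map N).prod := List.prod_nonneg fun a ha => by
      obtain ⟨i, _, rfl⟩ := List.mem_map.1 ha
      exact (h.blocks i).nonneg
    have hNi := (h.blocks i).nonneg
    obtain ⟨c, c', hc, heq⟩ := hcc N b F h x
    have hself : extIncrement F x x (w ++ [i]) = 0 := by
      rw [extIncrement_of_ne_nil _ _ _ (by simp), increment_self]
    have hdiff : extIncrement F y x (w ++ [i]) =
        (paraSum κ (fun z => extIncrement F z x w) (b i) y -
          paraSum κ (fun z => extIncrement F z x w) (b i) x) +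
        c * ((b i 0 y - b i 0 x) + (b i 1 y - b i 1 x)) := by
      rw [← sub_zero (extIncrement F y x (w ++ [i])), ← hself, heq, heq]
      ring
    have h1 := hps (K * (w.map N).prod) (N i) (fun z => extIncrement F z x w) (b i) x
      (hI N b F h x).1 ⟨_, (hI N b F h x).2⟩ (by positivity) (fun z => ih N b F h x z)
      (h.blocks i) y
    have hlow : ∀ k, k ≤ 1 → ‖b i k y - b i k x‖ ≤ 2 * N i * ‖y - x‖ ^ (β + α i) := by
      intro k hk
      have hk1 : ((2 : ℝ) ^ k) ^ (-α i) ≤ 1 :=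
        Real.rpow_le_one_of_one_le_of_nonpos (one_le_pow₀ one_le_two) (by linarith [hα i])
      have hk2 : (2 : ℝ) ^ k ≤ 2 := by
        simpa using pow_le_pow_right₀ (one_le_two (α := ℝ)) hk
      rcases le_total ‖y - x‖ 1 with hyx | hyx
      · calc ‖b i k y - b i k x‖ ≤ N i * ((2 : ℝ) ^ k) ^ (-α i) * ((2 : ℝ) ^ k * ‖y - x‖) :=
              (h.blocks i).norm_sub_le k x y
          _ ≤ N i * 1 * (2 * ‖y - x‖ ^ (1 : ℝ)) := by rw [Real.rpow_one]; gcongr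
          _ ≤ N i * 1 * (2 * ‖y - x‖ ^ (β + α i)) := by
            gcongr ?_ * (_ * ?_)
            exact Real.rpow_le_rpow_of_exponent_ge_of_imp (norm_nonneg _) hyx hw.le
              (fun _ hz => absurd hz (by linarith [hα i]))
          _ = _ := by ring
      · calc ‖b i k y - b i k x‖ ≤ ‖b i k y‖ + ‖b i k x‖ := norm_sub_le _ _
          _ ≤ N i * 1 + N i * 1 := by
            gcongr
            · exact ((h.blocks i).norm_le k y).trans (by gcongr)
            · exact ((h.blocks i).norm_le k x).trans (by gcongr)
          _ = 2 * N i * 1 := by ring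
          _ ≤ _ := by
            gcongr
            exact Real.one_le_rpow hyx (by linarith [hα i])
    rw [hdiff]
    calc _ ≤ C * (K * (w.map N).prod * N i * ‖y - x‖ ^ (β + α i)) +
          Q * (w.map N).prod * (2 * N i * ‖y - x‖ ^ (β + α i) + 2 * N i * ‖y - x‖ ^ (β + α i)) := by
          refine (norm_add_le _ _).trans (add_le_add h1 ?_)
          rw [norm_mul]
          refine mul_le_mul hc ((norm_add_le _ _).trans (add_le_add (hlow 0 zero_le_one)
            (hlow 1 le_rfl))) (norm_nonneg _) (by positivity)
      _ = _ := by
          simp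
          ring
end

/-! ### Convergence of low frequency cutoffs -/

/-- The derivatives of `a(t ·) - 1` are bounded and vanish on the ball of radius `δ / t`, so that
they gain a factor `t` at the cost of a factor `‖x‖`. -/
theorem exists_iteratedFDeriv_sub_one_bound (a : 𝓢(E d, ℂ)) {δ : ℝ} (hδ : 0 < δ)
    (ha : ∀ x, ‖x‖ < δ → a x = 1) (i : ℕ) : ∃ B : ℝ, 0 ≤ B ∧
      ∀ t x, 0 ≤ t → t ≤ 1 → ‖iteratedFDeriv ℝ i (fun y => a (t • y) - 1) x‖ ≤ B * (t * ‖x‖) := by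
  set η : E d → ℂ := fun y => a y - 1 with hη
  have hηs : ContDiff ℝ i η := (a.smooth i).sub contDiff_const
  have hb : ∀ y, ‖iteratedFDeriv ℝ i η y‖ ≤ SchwartzMap.seminorm ℝ 0 i a + 1 := by
    intro y
    have h1 : iteratedFDeriv ℝ i η y =
        iteratedFDeriv ℝ i a y - iteratedFDeriv ℝ i (fun _ : E d => (1 : ℂ)) y :=
      iteratedFDeriv_sub_apply (a.smooth i).contDiffAt contDiff_const.contDiffAt
    rw [h1]
    refine (norm_sub_le _ _).trans (add_le_add (a.norm_iteratedFDeriv_le_seminorm ℝ i y) ?_)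
    cases i with
    | zero => simp
    | succ i => simp [iteratedFDeriv_succ_const]
  have hpos : 0 ≤ SchwartzMap.seminorm ℝ 0 i a + 1 := (norm_nonneg _).trans (hb 0)
  refine ⟨(SchwartzMap.seminorm ℝ 0 i a + 1) / δ, by positivity, fun t x ht0 ht1 => ?_⟩
  have h2 : iteratedFDeriv ℝ i (fun y => a (t • y) - 1) x = t ^ i • iteratedFDeriv ℝ i η (t • x) :=
    congrFun (iteratedFDeriv_comp_const_smul t hηs) x
  rw [h2, norm_smul]
  have htx : ‖t • x‖ = t * ‖x‖ := by rw [norm_smul, Real.norm_of_nonneg ht0]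
  rcases lt_or_ge (t * ‖x‖) δ with h | h
  · have h0 : η =ᶠ[nhds (t • x)] fun _ => 0 := by
      filter_upwards [continuous_norm.isOpen_preimage _ isOpen_Iio |>.mem_nhds
        (show t • x ∈ norm ⁻¹' Set.Iio δ by simpa [htx] using h)] with y hy
      simp [hη, ha y hy]
    rw [(h0.iteratedFDeriv ℝ i).eq_of_nhds]
    simp only [iteratedFDeriv_fun_zero, Pi.zero_apply, norm_zero, mul_zero]
    positivity
  · calc ‖t ^ i‖ * ‖iteratedFDeriv ℝ i η (t • x)‖
        ≤ 1 * (SchwartzMap.seminorm ℝ 0 i a + 1) := by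
          gcongr
          · rw [norm_pow, Real.norm_of_nonneg ht0]; exact pow_le_one₀ ht0 ht1
          · exact hb _
      _ = (SchwartzMap.seminorm ℝ 0 i a + 1) / δ * δ := by field_simp
      _ ≤ _ := by gcongr

theorem tendsto_smulLeftCLM_dilate (a : 𝓢(E d, ℂ)) {δ : ℝ} (hδ : 0 < δ)
    (ha : ∀ x, ‖x‖ < δ → a x = 1) (ψ : 𝓢(E d, ℂ)) :
    Filter.Tendsto (fun N : ℕ => SchwartzMap.smulLeftCLM ℂ (fun ξ => a (((2 : ℝ) ^ N)⁻¹ • ξ)) ψ)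
      Filter.atTop (nhds ψ) := by
  rw [(schwartz_withSeminorms ℝ (E d) ℂ).tendsto_nhds]
  rintro ⟨k, n⟩ ε hε
  choose B hB hη using exists_iteratedFDeriv_sub_one_bound a hδ ha
  set C : ℝ := ∑ i ∈ Finset.range (n + 1),
    (n.choose i : ℝ) * B i * SchwartzMap.seminorm ℝ (k + 1) (n - i) ψ with hC
  have hC0 : 0 ≤ C := Finset.sum_nonneg fun i _ => by have := hB i; positivity
  have hbound : ∀ N : ℕ, schwartzSeminormFamily ℝ (E d) ℂ (k, n)
      (SchwartzMap.smulLeftCLM ℂ (fun ξ => a (((2 : ℝ) ^ N)⁻¹ • ξ)) ψ - ψ) ≤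
        ((2 : ℝ) ^ N)⁻¹ * C := by
    intro N
    set t : ℝ := ((2 : ℝ) ^ N)⁻¹ with ht
    have ht0 : 0 < t := by positivity
    have ht1 : t ≤ 1 := inv_le_one_of_one_le₀ (one_le_pow₀ one_le_two)
    have htg : Function.HasTemperateGrowth fun ξ : E d => a (t • ξ) :=
      (dilate a t ht0).hasTemperateGrowth
    refine SchwartzMap.seminorm_le_bound ℝ k n _ (by positivity) fun x => ?_
    have hfun : (⇑(SchwartzMap.smulLeftCLM ℂ (fun ξ => a (t • ξ)) ψ - ψ) : E d → ℂ) =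
        fun y => (a (t • y) - 1) * ψ y := by
      ext y
      simp [SchwartzMap.smulLeftCLM_apply_apply htg]
      ring
    rw [hfun]
    have hsm : ContDiff ℝ n fun y => a (t • y) - 1 :=
      ((dilate a t ht0).smooth n).sub contDiff_const
    have h1 := norm_iteratedFDeriv_mul_le hsm (ψ.smooth n) x (n := n) le_rfl
    calc ‖x‖ ^ k * ‖iteratedFDeriv ℝ n (fun y => (a (t • y) - 1) * ψ y) x‖
        ≤ ‖x‖ ^ k * ∑ i ∈ Finset.range (n + 1), (n.choose i : ℝ) *
            ‖iteratedFDeriv ℝ i (fun y => a (t • y) - 1) x‖ * ‖iteratedFDeriv ℝ (n - i) ψ x‖ := by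
          gcongr
      _ ≤ ‖x‖ ^ k * ∑ i ∈ Finset.range (n + 1), (n.choose i : ℝ) *
            (B i * (t * ‖x‖)) * ‖iteratedFDeriv ℝ (n - i) ψ x‖ := by
          gcongr with i
          exact hη i t x ht0.le ht1
      _ = t * ∑ i ∈ Finset.range (n + 1), (n.choose i : ℝ) * B i *
            (‖x‖ ^ (k + 1) * ‖iteratedFDeriv ℝ (n - i) ψ x‖) := by
          rw [Finset.mul_sum, Finset.mul_sum]
          exact Finset.sum_congr rfl fun i _ => by ring
      _ ≤ t * C := by
          refine mul_le_mul_of_nonneg_left (Finset.sum_le_sum fun i _ => ?_) ht0.le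
          have := hB i
          gcongr
          exact SchwartzMap.le_seminorm ℝ (k + 1) (n - i) ψ x
  have hlim : Filter.Tendsto (fun N : ℕ => ((2 : ℝ) ^ N)⁻¹ * C) Filter.atTop (nhds 0) := by
    have := (tendsto_pow_atTop_nhds_zero_of_lt_one (r := (1 / 2 : ℝ)) (by norm_num)
      (by norm_num)).mul_const C
    simpa using this
  filter_upwards [hlim.eventually_lt_const hε] with N hN
  exact (hbound N).trans_lt hN

theorem tendsto_fourierMultiplierCLM_dilate (a : 𝓢(E d, ℂ)) {δ : ℝ} (hδ : 0 < δ)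
    (ha : ∀ x, ‖x‖ < δ → a x = 1) (f : Distr d) :
    Filter.Tendsto (fun N : ℕ => fourierMultiplierCLM ℂ (fun ξ => a (((2 : ℝ) ^ N)⁻¹ • ξ)) f)
      Filter.atTop (nhds f) := by
  rw [PointwiseConvergenceCLM.tendsto_iff_forall_tendsto]
  intro φ
  simp only [fourierMultiplierCLM_apply_apply]
  have h1 := tendsto_smulLeftCLM_dilate a hδ ha (𝓕⁻ φ)
  have h2 : Filter.Tendsto (fun N : ℕ =>
      𝓕 (SchwartzMap.smulLeftCLM ℂ (fun ξ => a (((2 : ℝ) ^ N)⁻¹ • ξ)) (𝓕⁻ φ)))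
      Filter.atTop (nhds φ) := by
    have := ((FourierTransform.fourierCLM ℂ 𝓢(E d, ℂ)).continuous.tendsto _).comp h1
    simpa [Function.comp_def] using this
  exact (f.continuous.tendsto φ).comp h2

/-! ### Dyadic partitions of unity -/

theorem hasCompactSupport_of_tsupport_subset {a : E d → ℝ} {r : ℝ}
    (h : tsupport a ⊆ {x | ‖x‖ < r}) : HasCompactSupport a :=
  (isCompact_closedBall (0 : E d) r).of_isClosed_subset (isClosed_tsupport a) fun x hx => by
    simpa using (h hx).le

/-- A real valued test function, as a complex valued Schwartz function. -/
def schwartzOfReal (a : E d → ℝ) (ha : ContDiff ℝ ∞ a) (hs : HasCompactSupport a) : 𝓢(E d, ℂ) :=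
  (show HasCompactSupport (Complex.ofRealCLM ∘ a) from hs.comp_left rfl).toSchwartzMap
    (by fun_prop)

namespace IsDyadicPartition
variable {χ ρ : E d → ℝ} (h : IsDyadicPartition χ ρ)
include h

theorem χ_eq_zero {x : E d} (hx : 4 / 3 ≤ ‖x‖) : χ x = 0 := by
  by_contra hne
  exact absurd (h.supp_χ (subset_tsupport _ hne)) (not_lt.2 hx)

theorem ρ_eq_zero {x : E d} (hx : ‖x‖ ≤ 3 / 4 ∨ 8 / 3 ≤ ‖x‖) : ρ x = 0 := by
  by_contra hne
  have := h.supp_ρ (subset_tsupport _ hne)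
  rcases hx with hx | hx
  · exact absurd this.1 (not_lt.2 hx)
  · exact absurd this.2 (not_lt.2 hx)

/-- The function `χ` as a Schwartz function. -/
def χS : 𝓢(E d, ℂ) :=
  schwartzOfReal χ h.smooth_χ (hasCompactSupport_of_tsupport_subset h.supp_χ)

/-- The function `ρ` as a Schwartz function. -/
def ρS : 𝓢(E d, ℂ) :=
  schwartzOfReal ρ h.smooth_ρ
    (hasCompactSupport_of_tsupport_subset (h.supp_ρ.trans fun _ hx => hx.2))

theorem χ_eq_one {x : E d} (hx : ‖x‖ ≤ 3 / 4) : χ x = 1 := by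
  have h0 : ∀ j : ℕ, ρ (((2 : ℝ) ^ j)⁻¹ • x) = 0 := fun j => by
    refine h.ρ_eq_zero (Or.inl (le_trans ?_ hx))
    rw [norm_smul, norm_inv, norm_pow, Real.norm_two]
    exact mul_le_of_le_one_left (norm_nonneg _) (inv_le_one_of_one_le₀ (one_le_pow₀ one_le_two))
  simpa [h0] using h.sum_eq_one x

theorem summable_ρ (x : E d) : Summable fun j : ℕ => ρ (((2 : ℝ) ^ j)⁻¹ • x) := by
  obtain ⟨J, hJ⟩ := pow_unbounded_of_one_lt (‖x‖ * (4 / 3)) (one_lt_two (α := ℝ))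
  refine summable_of_ne_finset_zero (s := Finset.range J) fun j hj => ?_
  have hj' : J ≤ j := by simpa using hj
  refine h.ρ_eq_zero (Or.inl ?_)
  rw [norm_smul, norm_inv, norm_pow, Real.norm_two, inv_mul_le_iff₀ (by positivity)]
  have : (2 : ℝ) ^ J ≤ 2 ^ j := pow_le_pow_right₀ one_le_two hj'
  linarith

/-- The partial sums of the partition of unity are dilations of `χ`: compare the partition of unity
at `x` and at `2^{-N} x`. -/
theorem sum_symbol (N : ℕ) (x : E d) :
    ∑ j ∈ Finset.range (N + 1), symbol χ ρ j x = χ (((2 : ℝ) ^ N)⁻¹ • x) := by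
  rw [Finset.sum_range_succ']
  simp only [symbol]
  have h1 := h.sum_eq_one x
  have h2 := h.sum_eq_one (((2 : ℝ) ^ N)⁻¹ • x)
  rw [← (h.summable_ρ x).sum_add_tsum_nat_add N] at h1
  have h3 : ∀ j : ℕ, ρ (((2 : ℝ) ^ j)⁻¹ • ((2 : ℝ) ^ N)⁻¹ • x) = ρ (((2 : ℝ) ^ (j + N))⁻¹ • x) := by
    intro j
    rw [smul_smul, ← mul_inv, ← pow_add]
  simp_rw [h3] at h2
  linarith

theorem exists_symbol_eq (m : ℕ) : ∃ (a : 𝓢(E d, ℂ)) (t : ℝ), 0 < t ∧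
    (fun ξ => (symbol χ ρ m ξ : ℂ)) = fun ξ => a (t • ξ) := by
  cases m with
  | zero => exact ⟨h.χS, 1, one_pos, by ext ξ; rw [one_smul]; rfl⟩
  | succ j => exact ⟨h.ρS, ((2 : ℝ) ^ j)⁻¹, by positivity, rfl⟩

theorem hasTemperateGrowth_symbol (m : ℕ) :
    Function.HasTemperateGrowth fun ξ => (symbol χ ρ m ξ : ℂ) := by
  obtain ⟨a, t, ht, h⟩ := h.exists_symbol_eq m
  rw [h]
  exact (dilate a t ht).hasTemperateGrowth

theorem symbol_eq_zero (m : ℕ) {ξ : E d} (hξ : 4 / 3 ≤ ‖((2 : ℝ) ^ m)⁻¹ • ξ‖) :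
    symbol χ ρ m ξ = 0 := by
  cases m with
  | zero => exact h.χ_eq_zero (by simpa using hξ)
  | succ j =>
    refine h.ρ_eq_zero (Or.inr ?_)
    rw [norm_smul, norm_inv, norm_pow, Real.norm_two] at hξ ⊢
    rw [pow_succ, mul_inv] at hξ
    linarith

theorem sum_block (N : ℕ) (f : Distr d) :
    ∑ j ∈ Finset.range (N + 1), block χ ρ j f =
      fourierMultiplierCLM ℂ (fun ξ => h.χS (((2 : ℝ) ^ N)⁻¹ • ξ)) f := by
  have h1 := fourierMultiplierCLM_sum ℂ (s := Finset.range (N + 1))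
    (g := fun j (ξ : E d) => (symbol χ ρ j ξ : ℂ)) fun j _ => h.hasTemperateGrowth_symbol j
  have h2 : (fun ξ => ∑ j ∈ Finset.range (N + 1), (symbol χ ρ j ξ : ℂ)) =
      fun ξ => h.χS (((2 : ℝ) ^ N)⁻¹ • ξ) := by
    ext ξ
    rw [← Complex.ofReal_sum, h.sum_symbol]
    rfl
  rw [h2] at h1
  rw [h1, sum_apply]
  rfl

/-- The Littlewood–Paley blocks of a tempered distribution can only sum up to it. -/
theorem eq_of_hasSum_block {f v : Distr d} (hv : HasSum (fun k => block χ ρ k f) v) : v = f := by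
  have h1 := (Filter.tendsto_add_atTop_iff_nat 1).2 hv.tendsto_sum_nat
  simp_rw [h.sum_block] at h1
  exact tendsto_nhds_unique h1 (tendsto_fourierMultiplierCLM_dilate h.χS (δ := 3 / 4)
    (by norm_num) (fun x hx => by
      change ((χ x : ℝ) : ℂ) = 1
      rw [h.χ_eq_one hx.le, Complex.ofReal_one]) f)

end IsDyadicPartition

/-! ### Littlewood–Paley blocks of Besov functions -/

/-- Bernstein's inequality for Littlewood–Paley blocks. The block is reproduced by a multiplier with
symbol `θ(2^{-m} ·)` equal to `1` on its spectrum. -/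
theorem exists_block_bound (d : ℕ) : ∃ M : ℝ, 0 ≤ M ∧ ∀ χ ρ : E d → ℝ, IsDyadicPartition χ ρ →
    ∀ (m : ℕ) (f : Distr d), linftyNorm (block χ ρ m f) ≠ ⊤ →
      Continuous (toFun (block χ ρ m f)) ∧ Represents (toFun (block χ ρ m f)) (block χ ρ m f) ∧
      (∀ x, ‖toFun (block χ ρ m f) x‖ ≤ M * (linftyNorm (block χ ρ m f)).toReal) ∧
      ∀ x y, ‖toFun (block χ ρ m f) y - toFun (block χ ρ m f) x‖ ≤
        M * (linftyNorm (block χ ρ m f)).toReal * ((2 : ℝ) ^ m * ‖y - x‖) := by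
  let B : ContDiffBump (0 : E d) := ⟨4 / 3, 2, by norm_num, by norm_num⟩
  let θ : 𝓢(E d, ℂ) := schwartzOfReal B B.contDiff B.hasCompactSupport
  obtain ⟨M, hM, hconv⟩ := exists_scaledConv_bound_of_bounded (𝓕 θ)
  refine ⟨M, hM, fun χ ρ h m f hfin => ?_⟩
  set t : ℝ := ((2 : ℝ) ^ m)⁻¹ with ht
  have ht0 : 0 < t := by positivity
  have hθ : fourierMultiplierCLM ℂ (fun ξ => θ (t • ξ)) (block χ ρ m f) = block χ ρ m f := by
    have hθt : Function.HasTemperateGrowth fun ξ : E d => θ (t • ξ) :=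
      (dilate θ t ht0).hasTemperateGrowth
    rw [block, fourierMultiplierCLM_fourierMultiplierCLM_apply (h.hasTemperateGrowth_symbol m) hθt]
    congr 2
    ext ξ
    rw [Pi.mul_apply]
    rcases le_total ‖t • ξ‖ (4 / 3) with hξ | hξ
    · have : θ (t • ξ) = 1 := by
        change ((B (t • ξ) : ℝ) : ℂ) = 1
        rw [B.one_of_mem_closedBall (by simpa using hξ), Complex.ofReal_one]
      rw [this, mul_one]
    · rw [h.symbol_eq_zero m hξ]
      simp
  -- `linftyNorm` is an infimum, hence the detour through `r > linftyNorm`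
  have key : ∀ r, (linftyNorm (block χ ρ m f)).toReal < r →
      Continuous (toFun (block χ ρ m f)) ∧ Represents (toFun (block χ ρ m f)) (block χ ρ m f) ∧
      (∀ x, ‖toFun (block χ ρ m f) x‖ ≤ M * r) ∧
      ∀ x y, ‖toFun (block χ ρ m f) y - toFun (block χ ρ m f) x‖ ≤
        M * r * ((2 : ℝ) ^ m * ‖y - x‖) := by
    intro r hr
    obtain ⟨g, hg, hgr, hrep⟩ := exists_represents_of_linftyNorm_lt hfin hr
    have h1 := represents_fourierMultiplierCLM θ ht0 hg hgr hrep
    rw [hθ] at h1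
    have hc := continuous_scaledConv (𝓕 θ) ht0 hg hgr
    rw [toFun_eq_of_represents hc h1]
    have h2 := hconv t r g ht0 hg hgr
    refine ⟨hc, h1, h2.1, fun x y => (h2.2 x y).trans_eq ?_⟩
    rw [ht, div_inv_eq_mul, mul_comm ‖y - x‖]
  obtain ⟨h1, h2, -, -⟩ := key _ (lt_add_one _)
  set L := (linftyNorm (block χ ρ m f)).toReal with hL
  have lim : ∀ s c : ℝ, (∀ r, L < r → c ≤ M * r * s) → c ≤ M * L * s := by
    intro s c hc
    have hcont : Filter.Tendsto (fun r => M * r * s) (nhdsWithin L (Set.Ioi L))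
        (nhds (M * L * s)) :=
      (Continuous.tendsto (by fun_prop) L).mono_left nhdsWithin_le_nhds
    exact ge_of_tendsto hcont (by filter_upwards [self_mem_nhdsWithin] with r hr using hc r hr)
  refine ⟨h1, h2, fun x => ?_, fun x y => lim _ _ fun r hr => (key r hr).2.2.2 x y⟩
  simpa using lim 1 _ fun r hr => by simpa using (key r hr).2.2.1 x

theorem linftyNorm_block_le {χ ρ : E d → ℝ} {α : ℝ} (hα : α ≤ 1) {f : Distr d}
    (hf : MemBesov χ ρ α f) (m : ℕ) : linftyNorm (block χ ρ m f) ≠ ⊤ ∧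
      (linftyNorm (block χ ρ m f)).toReal ≤
        2 * (besovNorm χ ρ α f).toReal * ((2 : ℝ) ^ m) ^ (-α) := by
  have h1 : ENNReal.ofReal ((2 : ℝ) ^ (((m : ℝ) - 1) * α)) * linftyNorm (block χ ρ m f) ≤
      besovNorm χ ρ α f :=
    le_iSup (fun m : ℕ => ENNReal.ofReal ((2 : ℝ) ^ (((m : ℝ) - 1) * α)) *
      linftyNorm (block χ ρ m f)) m
  have hpos : 0 < (2 : ℝ) ^ (((m : ℝ) - 1) * α) := by positivity
  have hfin : linftyNorm (block χ ρ m f) ≠ ⊤ := by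
    intro htop
    rw [htop, ENNReal.mul_top (by simpa using hpos)] at h1
    exact hf.ne (top_le_iff.1 h1)
  refine ⟨hfin, ?_⟩
  have h2 := ENNReal.toReal_mono hf.ne h1
  rw [ENNReal.toReal_mul, ENNReal.toReal_ofReal hpos.le, ← le_div_iff₀' hpos] at h2
  refine h2.trans ?_
  rw [div_eq_mul_inv, ← Real.rpow_neg two_pos.le, mul_comm (2 : ℝ), mul_assoc]
  gcongr
  rw [show -(((m : ℝ) - 1) * α) = α + m * (-α) by ring, Real.rpow_add two_pos,
    Real.rpow_mul two_pos.le, Real.rpow_natCast]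
  gcongr
  simpa using Real.rpow_le_rpow_of_exponent_le one_le_two hα

/-- The blocks of an element of `𝒞^α` satisfy the size and Lipschitz bounds of `IsBlockSeq`. -/
theorem exists_isBlockSeq (d : ℕ) : ∃ M : ℝ, 0 ≤ M ∧ ∀ χ ρ : E d → ℝ, IsDyadicPartition χ ρ →
    ∀ (α : ℝ), α ≤ 1 → ∀ f : Distr d, MemBesov χ ρ α f →
      (∀ m, Represents (toFun (block χ ρ m f)) (block χ ρ m f)) ∧
      IsBlockSeq (fun m => toFun (block χ ρ m f)) α (M * (besovNorm χ ρ α f).toReal) := by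
  obtain ⟨M, hM, h⟩ := exists_block_bound d
  refine ⟨M * 2, by positivity, fun χ ρ hχρ α hα f hf => ?_⟩
  have h1 := fun m => linftyNorm_block_le hα hf m
  have h2 := fun m => h χ ρ hχρ m f (h1 m).1
  have h3 : ∀ m, M * (linftyNorm (block χ ρ m f)).toReal ≤
      M * 2 * (besovNorm χ ρ α f).toReal * ((2 : ℝ) ^ m) ^ (-α) := fun m => by
    rw [mul_assoc M, mul_assoc M]
    exact mul_le_mul_of_nonneg_left (h1 m).2 hM
  refine ⟨fun m => (h2 m).2.1, fun m x => ((h2 m).2.2.1 x).trans (h3 m), fun m x y =>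
    ((h2 m).2.2.2 x y).trans ?_⟩
  exact mul_le_mul_of_nonneg_right (h3 m) (by positivity)

/-! ### Paraproducts of distributions -/

namespace IsDyadicPartition
variable {χ ρ : E d → ℝ} (h : IsDyadicPartition χ ρ)
include h

/-- The kernel of the multiplier `χ(4 ·)`. As `χ(2^{-N} ·) = χ(4 · 2^{-(N + 2)} ·)`, its rescaling
by `2^{-k}` gives the low frequency part of a function that multiplies its `k`-th block in
paraproducts. -/
def lowKernel : 𝓢(E d, ℂ) := 𝓕 (dilate h.χS 4 four_pos)

theorem scaledConv_lowKernel_one (t : ℝ) (x : E d) :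
    scaledConv h.lowKernel t (fun _ => 1) x = 1 := by
  rw [lowKernel, scaledConv_fourier_one, dilate_apply, smul_zero]
  change ((χ 0 : ℝ) : ℂ) = 1
  rw [h.χ_eq_one (by norm_num), Complex.ofReal_one]

theorem represents_of_isBlockSeq {α N : ℝ} (hα : 0 < α) {f : Distr d}
    (hrep : ∀ m, Represents (toFun (block χ ρ m f)) (block χ ρ m f))
    (hb : IsBlockSeq (fun m => toFun (block χ ρ m f)) α N) :
    Represents (fun x => ∑' m, toFun (block χ ρ m f) x) f := by
  obtain ⟨v, hv, hvr⟩ := represents_tsum hrep hb.continuous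
    ((summable_two_pow_rpow_neg hα).mul_left N) hb.norm_le
  rwa [h.eq_of_hasSum_block hv] at hvr

theorem represents_block {H : E d → ℂ} (hc : Continuous H) {A : ℝ} (hA : ∀ x, ‖H x‖ ≤ A)
    {g : Distr d} (hg : Represents H g) (m : ℕ) :
    Continuous (toFun (block χ ρ m g)) ∧ Represents (toFun (block χ ρ m g)) (block χ ρ m g) := by
  obtain ⟨a, t, ht, hs⟩ := h.exists_symbol_eq m
  have h1 := represents_fourierMultiplierCLM a ht hc.measurable hA hg
  rw [← hs] at h1
  have h2 := continuous_scaledConv (𝓕 a) ht hc.measurable hA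
  have h3 := toFun_eq_of_represents h2 h1
  rw [block, h3]
  exact ⟨h2, h1⟩

theorem sum_toFun_block {H : E d → ℂ} (hc : Continuous H) {A : ℝ} (hA : ∀ x, ‖H x‖ ≤ A)
    {g : Distr d} (hg : Represents H g) (k : ℕ) (x : E d) :
    ∑ j ∈ Finset.range (k - 1), toFun (block χ ρ j g) x = lowPart h.lowKernel k H x := by
  by_cases hk : k < 2
  · have : k - 1 = 0 := by omega
    simp [lowPart, hk, this]
  obtain ⟨N, rfl⟩ : ∃ N, k = N + 2 := ⟨k - 2, by omega⟩
  have h1 := h.represents_block hc hA hg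
  have h2 := Represents.sum (s := Finset.range (N + 1)) fun j _ => (h1 j).2
  have h3 := represents_fourierMultiplierCLM (dilate h.χS 4 four_pos) (t := ((2 : ℝ) ^ (N + 2))⁻¹)
    (by positivity) hc.measurable hA hg
  have h4 : (fun ξ => dilate h.χS 4 four_pos (((2 : ℝ) ^ (N + 2))⁻¹ • ξ)) =
      fun ξ => h.χS (((2 : ℝ) ^ N)⁻¹ • ξ) := by
    ext ξ
    rw [dilate_apply, smul_smul]
    congr 2
    rw [pow_add]
    field_simp
    norm_num
  rw [h4, ← h.sum_block] at h3
  have h5 := toFun_eq_of_represents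
    (continuous_finsetSum (Finset.range (N + 1)) fun j _ => (h1 j).1) h2
  rw [toFun_eq_of_represents (continuous_scaledConv _ (by positivity) hc.measurable hA) h3] at h5
  simp only [lowPart, hk, if_false]
  exact (congrFun h5 x).symm

/-- The paraproduct of a bounded continuous function with an element of `𝒞^α`, `α > 0`, is the
normally convergent series `paraSum`. -/
theorem paraproduct_represents {H : E d → ℂ} (hc : Continuous H) {A : ℝ} (hA : ∀ x, ‖H x‖ ≤ A)
    {g : Distr d} (hg : Represents H g) {α N : ℝ} (hα : 0 < α) {f : Distr d}
    (hrep : ∀ m, Represents (toFun (block χ ρ m f)) (block χ ρ m f))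
    (hb : IsBlockSeq (fun m => toFun (block χ ρ m f)) α N) :
    ParaproductDefined χ ρ g f ∧
      Represents (paraSum h.lowKernel H fun m => toFun (block χ ρ m f)) (paraproduct χ ρ g f) := by
  obtain ⟨M, hM, hp⟩ := exists_paraSum_bound h.lowKernel hα
  obtain ⟨M', _, hl⟩ := exists_lowPart_bound h.lowKernel
  have hbound := (hp A N H _ hc hA hb).1
  have hterm : ∀ k, paraTerm χ ρ g f k =
      fun x => lowPart h.lowKernel k H x * toFun (block χ ρ k f) x := by
    intro k
    ext x
    rw [paraTerm, ← Finset.sum_mul, h.sum_toFun_block hc hA hg]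
  have hcont : ∀ k, Continuous (paraTerm χ ρ g f k) := fun k => by
    rw [hterm]
    exact (hl A H hc hA k).1.mul (hb.continuous k)
  have hle : ∀ k x, ‖paraTerm χ ρ g f k x‖ ≤ M * A * N * ((2 : ℝ) ^ k) ^ (-α) := fun k x => by
    rw [hterm]
    exact hbound k x
  have hex : ∀ k, ∃ u, Represents (paraTerm χ ρ g f k) u := fun k =>
    exists_represents (hcont k).measurable (hle k)
  obtain ⟨v, hv, hvr⟩ := represents_tsum (fun k => represents_ofFun (hex k)) hcont
    ((summable_two_pow_rpow_neg hα).mul_left _) hle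
  refine ⟨⟨fun m => ⟨_, (h.represents_block hc hA hg m).1, (h.represents_block hc hA hg m).2⟩,
    fun m => ⟨_, hb.continuous m, hrep m⟩, hex, hv.summable⟩, ?_⟩
  rw [paraproduct, hv.tsum_eq]
  have : (fun x => ∑' k, paraTerm χ ρ g f k x) =
      paraSum h.lowKernel H fun m => toFun (block χ ρ m f) := by
    ext x
    simp only [hterm, paraSum]
  rwa [← this]

end IsDyadicPartition

theorem iterPara_append (χ ρ : E d → ℝ) {fs : List (Distr d)} (hfs : fs ≠ []) (f : Distr d) :
    iterPara χ ρ (fs ++ [f]) = paraproduct χ ρ (iterPara χ ρ fs) f := by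
  cases fs with
  | nil => exact absurd rfl hfs
  | cons g gs => simp [iterPara, List.foldl_append]

section
variable {χ ρ : E d → ℝ} (h : IsDyadicPartition χ ρ) {ι : Type*} {α N : ι → ℝ}
  (hα : ∀ i, 0 < α i) {f : ι → Distr d}
  (hrep : ∀ i m, Represents (toFun (block χ ρ m (f i))) (block χ ρ m (f i)))
  (hb : ∀ i, IsBlockSeq (fun m => toFun (block χ ρ m (f i))) (α i) (N i))
include h hα hrep hb

theorem represents_iterPara (w : List ι) (hw : w ≠ []) :
    Continuous (toFun (iterPara χ ρ (w.map f))) ∧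
    (∃ A, ∀ x, ‖toFun (iterPara χ ρ (w.map f)) x‖ ≤ A) ∧
    Represents (toFun (iterPara χ ρ (w.map f))) (iterPara χ ρ (w.map f)) := by
  induction w using List.reverseRecOn with
  | nil => exact absurd rfl hw
  | append_singleton w i ih =>
    by_cases hw' : w = []
    · subst hw'
      have hs := (summable_two_pow_rpow_neg (hα i)).mul_left (N i)
      have h1 := h.represents_of_isBlockSeq (hα i) (hrep i) (hb i)
      have hc := continuous_tsum (hb i).continuous hs (hb i).norm_le
      have h2 := toFun_eq_of_represents hc h1
      change Continuous (toFun (f i)) ∧ (∃ A, ∀ x, ‖toFun (f i) x‖ ≤ A) ∧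
        Represents (toFun (f i)) (f i)
      rw [h2]
      exact ⟨hc, ⟨_, fun x => tsum_of_norm_bounded hs.hasSum fun k => (hb i).norm_le k x⟩, h1⟩
    · obtain ⟨hc, ⟨A, hA⟩, hr⟩ := ih hw'
      rw [List.map_append, List.map_singleton, iterPara_append χ ρ (by simpa using hw')]
      have h1 := (h.paraproduct_represents hc hA hr (hα i) (hrep i) (hb i)).2
      obtain ⟨M, _, hp⟩ := exists_paraSum_bound h.lowKernel (hα i)
      have h2 := (hp A (N i) _ _ hc hA (hb i)).2
      rw [toFun_eq_of_represents h2.1 h1]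
      exact ⟨h2.1, ⟨_, h2.2⟩, h1⟩

open Classical in
theorem isParaModel_iterPara : IsParaModel h.lowKernel α N
    (fun i m => toFun (block χ ρ m (f i)))
    (fun w => if w = [] then fun _ => 1 else toFun (iterPara χ ρ (w.map f))) := by
  refine ⟨hb, if_pos rfl, fun i x => ?_, fun w i hw => ?_⟩
  · rw [if_neg (by simp)]
    have h1 := h.represents_of_isBlockSeq (hα i) (hrep i) (hb i)
    have hc := continuous_tsum (hb i).continuous
      ((summable_two_pow_rpow_neg (hα i)).mul_left (N i)) (hb i).norm_le
    exact congrFun (toFun_eq_of_represents hc h1) x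
  · rw [if_neg hw, if_neg (by simp), List.map_append, List.map_singleton,
      iterPara_append χ ρ (by simpa using hw)]
    obtain ⟨hc, ⟨A, hA⟩, hr⟩ := represents_iterPara h hα hrep hb w hw
    obtain ⟨M, _, hp⟩ := exists_paraSum_bound h.lowKernel (hα i)
    exact toFun_eq_of_represents (hp A (N i) _ _ hc hA (hb i)).2.1
      (h.paraproduct_represents hc hA hr (hα i) (hrep i) (hb i)).2

end

/-! ### Seeds -/

theorem finite_words {n : ℕ} {α : Fin n → ℝ} (hα : ∀ i, 0 < α i) : (words α).Finite := by
  obtain ⟨δ, hδ, hδα⟩ : ∃ δ > 0, ∀ i, δ ≤ α i := by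
    rcases isEmpty_or_nonempty (Fin n) with he | hne
    · exact ⟨1, one_pos, fun i => he.elim i⟩
    · obtain ⟨i, hi⟩ := Finite.exists_min α
      exact ⟨α i, hα i, hi⟩
  obtain ⟨L, hL⟩ := exists_nat_gt δ⁻¹
  refine (List.finite_length_le (Fin n) L).subset fun w hw => ?_
  have h1 : (w.length : ℝ) * δ ≤ homogeneity α w := by
    have := List.card_nsmul_le_sum (w.map α) δ fun x hx => by
      obtain ⟨i, _, rfl⟩ := List.mem_map.1 hx
      exact hδα i
    simpa [homogeneity] using this
  have h2 : (w.length : ℝ) < L := by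
    refine lt_of_le_of_lt ?_ hL
    rw [inv_eq_one_div, le_div_iff₀ hδ]
    exact h1.trans hw.2.le
  exact_mod_cast h2.le

theorem exists_increment_paraFamily_bound {χ ρ : E d → ℝ} (h : IsDyadicPartition χ ρ) {n : ℕ}
    {α : Fin n → ℝ} (hα : ∀ i, α i ∈ Set.Ioo (0 : ℝ) 1) : ∃ C : ℝ, 0 ≤ C ∧
    ∀ f : Fin n → Distr d, (∀ i, MemBesov χ ρ (α i) (f i)) → ∀ w ∈ words α, ∀ x y : E d,
      ‖increment (paraFamily χ ρ f) y x w‖ ≤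
        C * (w.map fun i => (besovNorm χ ρ (α i) (f i)).toReal).prod *
          ‖y - x‖ ^ homogeneity α w := by
  classical
  obtain ⟨M, hM, hblock⟩ := exists_isBlockSeq d
  have hex : ∀ w : List (Fin n), ∃ K : ℝ, 0 ≤ K ∧ (w ∈ words α → ∀ N b F,
      IsParaModel h.lowKernel α N b F → ∀ x y,
        ‖extIncrement F y x w‖ ≤ K * (w.map N).prod * ‖y - x‖ ^ (w.map α).sum) := by
    intro w
    by_cases hw : w ∈ words α
    · obtain ⟨K, hK, hw'⟩ := exists_extIncrement_holder h.scaledConv_lowKernel_one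
        (fun i => (hα i).1) w hw.2
      exact ⟨K, hK, fun _ => hw'⟩
    · exact ⟨0, le_rfl, fun hw' => absurd hw' hw⟩
  choose K hK hmain using hex
  have hfin := finite_words fun i => (hα i).1
  have hnn : ∀ w : List (Fin n), 0 ≤ K w * M ^ w.length := fun w =>
    mul_nonneg (hK w) (pow_nonneg hM _)
  refine ⟨∑ w ∈ hfin.toFinset, K w * M ^ w.length, Finset.sum_nonneg fun w _ => hnn w,
    fun f hf w hw x y => ?_⟩
  have hb := fun i => hblock χ ρ h (α i) (hα i).2.le (f i) (hf i)
  have hmodel := isParaModel_iterPara h (fun i => (hα i).1) (fun i => (hb i).1) fun i => (hb i).2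
  have h1 := hmain w hw _ _ _ hmodel x y
  rw [extIncrement_of_ne_nil _ _ _ hw.1,
    increment_congr (G := paraFamily χ ρ f) (fun v hv => by simp [hv, paraFamily]) y x hw.1] at h1
  refine h1.trans ?_
  have hprod : (w.map fun i => M * (besovNorm χ ρ (α i) (f i)).toReal).prod =
      M ^ w.length * (w.map fun i => (besovNorm χ ρ (α i) (f i)).toReal).prod := by
    rw [List.prod_map_mul]
    simp
  rw [hprod, ← mul_assoc]
  have hpn : 0 ≤ (w.map fun i => (besovNorm χ ρ (α i) (f i)).toReal).prod :=
    List.prod_nonneg fun a ha => by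
      obtain ⟨i, _, rfl⟩ := List.mem_map.1 ha
      exact ENNReal.toReal_nonneg
  refine mul_le_mul_of_nonneg_right (mul_le_mul_of_nonneg_right ?_ hpn) (by positivity)
  exact Finset.single_le_sum (f := fun w => K w * M ^ w.length) (fun w _ => hnn w)
    (hfin.mem_toFinset.2 hw)

/-- As there are finitely many words of homogeneity `< 1`, a family is a seed as soon as each of its
members satisfies the required bounds. -/
theorem isSeed_of_bounds {n : ℕ} {α : Fin n → ℝ} (hα : ∀ i, 0 < α i)
    {F : List (Fin n) → E d → ℂ} (hF : ∀ w ∈ words α, ∃ A : ℝ, ∀ x, ‖F w x‖ ≤ A)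
    (hω : ∀ w ∈ words α, ∃ A : ℝ, ∀ x y,
      ‖increment F y x w‖ ≤ A * ‖y - x‖ ^ homogeneity α w) : IsSeed α F := by
  have hfin := finite_words hα
  have sup : ∀ (s : List (Fin n) → ℝ≥0∞), (∀ w ∈ words α, ∃ A : ℝ, s w ≤ ENNReal.ofReal A) →
      ⨆ w ∈ words α, s w < ⊤ := by
    intro s hs
    refine lt_of_le_of_lt (b := ∑ w ∈ hfin.toFinset, s w) (iSup₂_le fun w hw => ?_) ?_
    · exact Finset.single_le_sum_of_canonicallyOrdered (f := s) (hfin.mem_toFinset.2 hw)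
    · refine ENNReal.sum_lt_top.2 fun w hw => ?_
      obtain ⟨A, hA⟩ := hs w (hfin.mem_toFinset.1 hw)
      exact hA.trans_lt ENNReal.ofReal_lt_top
  refine ENNReal.add_lt_top.2 ⟨sup _ fun w hw => ?_, sup _ fun w hw => ?_⟩
  · obtain ⟨A, hA⟩ := hF w hw
    refine ⟨A, iSup_le fun x => ?_⟩
    rw [← ofReal_norm]
    exact ENNReal.ofReal_le_ofReal (hA x)
  · obtain ⟨A, hA⟩ := hω w hw
    refine ⟨A, iSup_le fun x => iSup_le fun y => ENNReal.div_le_of_le_mul ?_⟩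
    rw [← ofReal_norm, ← ENNReal.ofReal_mul' (by positivity)]
    exact ENNReal.ofReal_le_ofReal (hA x y)

end IterPara

end

theorem theorem3p1 (d : ℕ) (χ ρ : IterPara.E d → ℝ) (hχρ : IterPara.IsDyadicPartition χ ρ)
    (n : ℕ) (hn : 1 ≤ n) (α : Fin n → ℝ) (hα : ∀ i, α i ∈ Set.Ioo (0 : ℝ) 1) :
    -- the iterated paraproducts are well defined bounded continuous functions
    (∀ f : Fin n → IterPara.Distr d, (∀ i, IterPara.MemBesov χ ρ (α i) (f i)) →
      ∀ w : List (Fin n), w ≠ [] →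
        (∀ i, IterPara.ParaproductDefined χ ρ (IterPara.iterPara χ ρ (w.map f)) (f i)) ∧
        IterPara.IsContFun (IterPara.iterPara χ ρ (w.map f)) ∧
        ∃ M : ℝ, ∀ x, ‖IterPara.toFun (IterPara.iterPara χ ρ (w.map f)) x‖ ≤ M) ∧
    -- the local behavior of the iterated paraproduct
    (∑ i, α i < 1 →
      ∃ C : ℝ, ∀ f : Fin n → IterPara.Distr d, (∀ i, IterPara.MemBesov χ ρ (α i) (f i)) →
        ∀ x y : IterPara.E d,
          ‖IterPara.omegaPara χ ρ y x (List.ofFn f)‖ ≤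
            C * (∏ i, (IterPara.besovNorm χ ρ (α i) (f i)).toReal) * ‖y - x‖ ^ (∑ i, α i)) ∧
    -- the iterated paraproducts form a seed of model, with the corresponding bounds
    (∃ C : ℝ, ∀ f : Fin n → IterPara.Distr d, (∀ i, IterPara.MemBesov χ ρ (α i) (f i)) →
      IterPara.IsSeed α (IterPara.paraFamily χ ρ f) ∧
      ∀ w ∈ IterPara.words α, ∀ x y : IterPara.E d,
        ‖IterPara.increment (IterPara.paraFamily χ ρ f) y x w‖ ≤
          C * (w.map fun i => (IterPara.besovNorm χ ρ (α i) (f i)).toReal).prod *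
            ‖y - x‖ ^ IterPara.homogeneity α w) := by
  obtain ⟨C, -, hC⟩ := IterPara.exists_increment_paraFamily_bound hχρ hα
  obtain ⟨M, -, hblock⟩ := IterPara.exists_isBlockSeq d
  have hpos := fun i => (hα i).1
  have hb := fun (f : Fin n → IterPara.Distr d) (hf : ∀ i, IterPara.MemBesov χ ρ (α i) (f i)) i =>
    hblock χ ρ hχρ (α i) (hα i).2.le (f i) (hf i)
  have hrep := fun f hf => IterPara.represents_iterPara hχρ hpos
    (fun i => (hb f hf i).1) fun i => (hb f hf i).2
  refine ⟨fun f hf w hw => ?_, fun hsum => ⟨C, fun f hf x y => ?_⟩,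
    C, fun f hf => ⟨?_, hC f hf⟩⟩
  · obtain ⟨hc, ⟨A, hA⟩, hr⟩ := hrep f hf w hw
    exact ⟨fun i => (hχρ.paraproduct_represents hc hA hr (hpos i) (hb f hf i).1 (hb f hf i).2).1,
      ⟨_, hc, hr⟩, A, hA⟩
  · have hhom : IterPara.homogeneity α (List.finRange n) = ∑ i, α i := by
      rw [IterPara.homogeneity, ← List.ofFn_eq_map, List.sum_ofFn]
    have hmem : List.finRange n ∈ IterPara.words α :=
      ⟨by rw [Ne, List.finRange_eq_nil_iff]; omega, by rwa [hhom]⟩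
    have h1 := hC f hf _ hmem x y
    rw [hhom, ← List.ofFn_eq_map, List.prod_ofFn] at h1
    rw [IterPara.omegaPara, List.ofFn_eq_map, IterPara.increment_map]
    exact h1
  · exact IterPara.isSeed_of_bounds hpos (fun w hw => (hrep f hf w hw.1).2.1)
      fun w hw => ⟨_, hC f hf w hw⟩
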